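/- Let $I$ be a Polish space and $H$ a non-atomic Borel probability measure on $I$. For $0\le\alpha<1$ and $\theta>-\alpha$, let $\Pi_{\alpha,\theta}$ denote the two-parameter Poisson–Dirichlet law with base distribution $H$, that is, the law of the random probability measure $$\sum_{k=1}^{\infty} V_k\prod_{j=1}^{k-1}(1-V_j)\,\delta_{Z_k},$$ where the $V_k$ are independent $\mathrm{beta}(1-\alpha,\theta+k\alpha)$ random variables and, independently of them, the $Z_k$ are i.i.d. with law $H$. **Proposition 4.1.** Let $0<\alpha<1$, $\theta>0$ and $n\in\{0,1,2,\dots\}$, and let $P_{\alpha,\theta+n\alpha}$ be a random probability measure on $I$ with law $\Pi_{\alpha,\theta+n\alpha}$. On some probability space let $P_{\alpha,\theta}$ have law $\Pi_{\alpha,\theta}$, let $P^{(1)}_{\alpha,\alpha},\dots,P^{(n)}_{\alpha,\alpha}$ have law $\Pi_{\alpha,\alpha}$, let $G_\theta$ be a $\mathrm{gamma}(\theta,1)$ random variable and let $G_{\alpha,1},\dots,G_{\alpha,n}$ be $\mathrm{gamma}(\alpha,1)$ random variables, all these $2n+2$ random elements being mutually independent. Put $G_{\theta+n\alpha}=G_\theta+\sum_{i=1}^n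 G_{\alpha,i}$. Then $$P_{\alpha,\theta+n\alpha}(\cdot)\ \stackrel{d}{=}\ \frac{G_\theta}{G_{\theta+n\alpha}}\,P_{\alpha,\theta}(\cdot)+\sum_{i=1}^n\frac{G_{\alpha,i}}{G_{\theta+n\alpha}}\,P^{(i)}_{\alpha,\alpha}(\cdot),$$ as random measures on $I$, i.e. with equal laws on the space of measures on $I$ with the $\sigma$-algebra generated by the evaluations $\nu\mapsto\nu(A)$, $A\subseteq I$ Borel. -/

import Mathlib

open MeasureTheory ProbabilityTheory

open scoped ENNReal

namespace PoissonDirichlet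

/-- The stick-breaking weights: with indices starting at `0`,
`weight v k = v k * ∏_{j < k} (1 - v j)`. -/
noncomputable def weight (v : ℕ → ℝ) (k : ℕ) : ℝ :=
  v k * ∏ j ∈ Finset.range k, (1 - v j)

/-- The discrete measure `∑ₖ (v k ∏_{j < k} (1 - v j)) δ_{z k}` built from fractions `v`
(in `[0, 1]`) and locations `z`. -/
noncomputable def stickBreaking {I : Type*} [MeasurableSpace I] (v : ℕ → ℝ) (z : ℕ → I) :
    Measure I :=
  Measure.sum fun k => ENNReal.ofReal (weight v k) • Measure.dirac (z k)

/-- The law of the sequence of fractions: they are independent and the fraction with index `k`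
(the `(k + 1)`-st one) is beta distributed with parameters `1 - α` and `θ + (k + 1) α`. -/
noncomputable def fractionLaw (α θ : ℝ) : Measure (ℕ → ℝ) :=
  Measure.infinitePi fun k : ℕ => betaMeasure (1 - α) (θ + ((k : ℝ) + 1) * α)

/-- The two-parameter Poisson–Dirichlet law `Π_{α,θ}` with base distribution `H`
(for `0 ≤ α < 1` and `θ > -α`): the law of the random measure `∑ₖ Vₖ ∏_{j < k} (1 - Vⱼ) δ_{Zₖ}`,
where the fractions `Vₖ` are as in `fractionLaw` and, independently of them, the locations `Zₖ` are
i.i.d. with law `H`. It is a law on the space of measures on `I`, with the σ-algebra generated by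
the evaluations at measurable sets. -/
noncomputable def law {I : Type*} [MeasurableSpace I] (α θ : ℝ) (H : Measure I) :
    Measure (Measure I) :=
  ((fractionLaw α θ).prod (Measure.infinitePi fun _ : ℕ => H)).map
    fun p => stickBreaking p.1 p.2

/-- `P`, a random probability measure on `I` defined on the probability space `(Ω, μ)`,
is an `(α, θ)` Poisson–Dirichlet process with base distribution `H`. -/
def IsProcess {Ω I : Type*} [MeasurableSpace Ω] [MeasurableSpace I] (α θ : ℝ) (H : Measure I)
    (P : Ω → ProbabilityMeasure I) (μ : Measure Ω) : Prop :=
  HasLaw (fun ω => (P ω : Measure I)) (law α θ H) μ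

/-- The stick-breaking map is measurable, so that `law` is a genuine push-forward. -/
theorem measurable_stickBreaking {I : Type*} [MeasurableSpace I] :
    Measurable fun p : (ℕ → ℝ) × (ℕ → I) => stickBreaking p.1 p.2 := by
  refine Measure.measurable_of_measurable_coe _ fun s hs => ?_
  simp only [stickBreaking, Measure.sum_apply _ hs, Measure.smul_apply, smul_eq_mul]
  refine Measurable.tsum fun k => ?_
  have h1 : Measurable fun p : (ℕ → ℝ) × (ℕ → I) => weight p.1 k := by
    unfold weight
    fun_prop
  have h2 : Measurable fun p : (ℕ → ℝ) × (ℕ → I) => Measure.dirac (p.2 k) s :=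
    (Measure.measurable_coe hs).comp (Measure.measurable_dirac.comp (by fun_prop))
  exact h1.ennreal_ofReal.mul h2

/-- In the admissible range of the parameters, `law α θ H` is a probability measure. -/
theorem isProbabilityMeasure_law {I : Type*} [MeasurableSpace I] {α θ : ℝ} (hα0 : 0 ≤ α)
    (hα1 : α < 1) (hθ : -α < θ) (H : Measure I) [IsProbabilityMeasure H] :
    IsProbabilityMeasure (law α θ H) := by
  have : ∀ k : ℕ, IsProbabilityMeasure (betaMeasure (1 - α) (θ + ((k : ℝ) + 1) * α)) := by
    intro k
    refine isProbabilityMeasureBeta (by linarith) ?_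
    have : 0 ≤ (k : ℝ) * α := by positivity
    linarith
  unfold law fractionLaw
  exact Measure.isProbabilityMeasure_map measurable_stickBreaking.aemeasurable

end PoissonDirichlet

/-! Multiply a process with law Π_{α,t}, t > 0, by an independent gamma(t) variable. The resulting
laws form a convolution semigroup in t (`scaledLaw_conv_scaledLaw`). The right-hand side of the
theorem is a sum of n + 1 such independent random measures, with parameters θ, α, …, α, divided by
its total mass; the division removes the gamma factor and leaves Π_{α,θ+nα}.

By beta-gamma algebra the semigroup property reduces to `mixLaw_eq_law`: if B ~ beta(t, s), P ~
Π_{α,t} and P' ~ Π_{α,s} are independent, then B P + (1 - B) P' has law Π_{α,t+s}. Both laws obey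
one recursion. Breaking off the first stick expresses Π_{α,u} through Π_{α,u+α} by the operator
`stick`. Size-biasing B and recutting a Dirichlet vector expresses the mixture with parameters (t,
s), by the same operator with u = t + s, through a convex combination of the mixtures with
parameters (t + α, s) and (s + α, t), whose total is again u + α (`lintegral_mixLaw_eq_add`).

Iterating, the discrepancy between the two laws on a Lipschitz functional is multiplied at each step
by E(1 - V) = (u + α)/(u + 1). The product of these factors tends to 0 because the harmonic series
diverges, and Lipschitz functionals determine the law (`ext_of_forall_isSubprobLipschitz`). -/

namespace PoissonDirichlet

/-! ### Beta and gamma integrals -/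

@[fun_prop]
theorem measurable_gammaPDF (a r : ℝ) : Measurable (gammaPDF a r) :=
  (measurable_gammaPDFReal a r).ennreal_ofReal

@[fun_prop]
theorem measurable_betaPDF (a b : ℝ) : Measurable (betaPDF a b) :=
  (measurable_betaPDFReal a b).ennreal_ofReal

theorem lintegral_gammaMeasure (a r : ℝ) {f : ℝ → ℝ≥0∞} (hf : Measurable f) :
    ∫⁻ x, f x ∂gammaMeasure a r = ∫⁻ x, gammaPDF a r x * f x := by
  rw [gammaMeasure, lintegral_withDensity_eq_lintegral_mul _ (measurable_gammaPDF a r) hf]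
  rfl

theorem lintegral_betaMeasure (a b : ℝ) {f : ℝ → ℝ≥0∞} (hf : Measurable f) :
    ∫⁻ x, f x ∂betaMeasure a b = ∫⁻ x, betaPDF a b x * f x := by
  rw [betaMeasure, lintegral_withDensity_eq_lintegral_mul _ (measurable_betaPDF a b) hf]
  rfl

theorem ae_betaMeasure_mem_Ioo (a b : ℝ) : ∀ᵐ v ∂betaMeasure a b, v ∈ Set.Ioo (0 : ℝ) 1 := by
  rw [betaMeasure, ae_withDensity_iff (measurable_betaPDF a b)]
  refine Filter.Eventually.of_forall fun v hv => ?_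
  by_contra h
  refine hv ?_
  rw [Set.mem_Ioo, not_and_or, not_lt, not_lt] at h
  exact h.elim betaPDF_eq_zero_of_nonpos betaPDF_eq_zero_of_one_le

theorem ae_gammaMeasure_pos (a r : ℝ) : ∀ᵐ x ∂gammaMeasure a r, 0 < x := by
  rw [gammaMeasure, ae_withDensity_iff (measurable_gammaPDF a r)]
  filter_upwards [Measure.ae_ne volume (0 : ℝ)] with x hx0 hx
  by_contra h
  exact hx (gammaPDF_of_neg (lt_of_le_of_ne (not_lt.1 h) hx0))

/-- The substitution `x = w * b` in a Lebesgue integral. -/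
theorem lintegral_eq_lintegral_comp_mul_left (g : ℝ → ℝ≥0∞) (hg : Measurable g) {w : ℝ}
    (hw : 0 < w) : ∫⁻ x, g x = ∫⁻ b, ENNReal.ofReal w * g (w * b) := by
  conv_lhs => rw [← Real.smul_map_volume_mul_left hw.ne', lintegral_smul_measure,
    lintegral_map hg (by fun_prop), abs_of_pos hw]
  rw [lintegral_const_mul _ (by fun_prop), smul_eq_mul]

/-- The density identity behind the beta-gamma algebra. -/
theorem gammaPDF_mul_gammaPDF {a b : ℝ} (ha : 0 < a) (hb : 0 < b) {w p : ℝ} (hw : 0 < w)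
    (h0 : p ≠ 0) (h1 : p ≠ 1) :
    ENNReal.ofReal w * (gammaPDF a 1 (w * p) * gammaPDF b 1 (w * (1 - p))) =
      betaPDF a b p * gammaPDF (a + b) 1 w := by
  rcases lt_or_gt_of_ne h0 with h0 | h0
  · rw [betaPDF_eq_zero_of_nonpos h0.le, gammaPDF_of_neg (mul_neg_of_pos_of_neg hw h0)]
    simp
  rcases lt_or_gt_of_ne h1 with h1 | h1
  swap
  · rw [betaPDF_eq_zero_of_one_le h1.le,
      gammaPDF_of_neg (x := w * (1 - p)) (mul_neg_of_pos_of_neg hw (by linarith))]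
    simp
  have hq : 0 < 1 - p := by linarith
  have hGa := Real.Gamma_pos_of_pos ha
  have hGb := Real.Gamma_pos_of_pos hb
  have hGab := Real.Gamma_pos_of_pos (add_pos ha hb)
  have hB := beta_pos ha hb
  rw [gammaPDF_of_nonneg (by positivity), gammaPDF_of_nonneg (by positivity),
    gammaPDF_of_nonneg hw.le, betaPDF_of_pos_lt_one h0 h1, ← ENNReal.ofReal_mul (by positivity),
    ← ENNReal.ofReal_mul hw.le, ← ENNReal.ofReal_mul (by positivity)]
  congr 1
  rw [Real.mul_rpow hw.le h0.le, Real.mul_rpow hw.le hq.le]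
  -- The isolated factor `w` is the Jacobian of x = w p.
  have e1 : w ^ (a + b - 1) = w * w ^ (a - 1) * w ^ (b - 1) := by
    rw [← Real.rpow_one_add' hw.le (by linarith), ← Real.rpow_add hw]
    congr 1; ring
  have e2 : Real.exp (-(1 * w)) =
      Real.exp (-(1 * (w * p))) * Real.exp (-(1 * (w * (1 - p)))) := by
    rw [← Real.exp_add]; congr 1; ring
  rw [e1, e2, beta]
  simp only [Real.one_rpow]
  field_simp

/-- Beta-gamma algebra: if `B ~ beta(a, b)` and `W ~ gamma(a + b)` are independent, then
`W B` and `W (1 - B)` are independent `gamma(a)` and `gamma(b)` variables. -/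
theorem lintegral_gammaMeasure_gammaMeasure {a b : ℝ} (ha : 0 < a) (hb : 0 < b)
    {f : ℝ → ℝ → ℝ≥0∞} (hf : Measurable (Function.uncurry f)) :
    ∫⁻ x, ∫⁻ y, f x y ∂gammaMeasure b 1 ∂gammaMeasure a 1 =
      ∫⁻ p, ∫⁻ w, f (w * p) (w * (1 - p)) ∂gammaMeasure (a + b) 1 ∂betaMeasure a b := by
  have hga := measurable_gammaPDF a 1
  have hgb := measurable_gammaPDF b 1
  have hgab := measurable_gammaPDF (a + b) 1
  have hbe := measurable_betaPDF a b
  have hf' : ∀ {γ : Type} [MeasurableSpace γ] {u v : γ → ℝ}, Measurable u → Measurable v →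
      Measurable fun c => f (u c) (v c) := fun hu hv => hf.comp (hu.prodMk hv)
  have := isProbabilityMeasure_gammaMeasure hb one_pos
  have := isProbabilityMeasure_gammaMeasure (add_pos ha hb) one_pos
  rw [lintegral_gammaMeasure _ _ hf.lintegral_prod_right,
    lintegral_betaMeasure _ _
      (Measurable.lintegral_prod_right' (f := fun q : ℝ × ℝ => f (q.2 * q.1) (q.2 * (1 - q.1)))
        (hf' (by fun_prop) (by fun_prop)))]
  -- Change variables to the total w = x + y, then, for fixed w > 0, to the fraction p = x / w.
  calc ∫⁻ x, gammaPDF a 1 x * ∫⁻ y, f x y ∂gammaMeasure b 1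
      = ∫⁻ x, ∫⁻ w, gammaPDF a 1 x * (gammaPDF b 1 (w - x) * f x (w - x)) := by
        refine lintegral_congr fun x => ?_
        rw [lintegral_gammaMeasure _ _ (f := f x)
            (hf' measurable_const measurable_id),
          ← lintegral_sub_right_eq_self _ x, lintegral_const_mul]
        exact (hgb.comp (by fun_prop)).mul (hf' (by fun_prop) (by fun_prop))
    _ = ∫⁻ w, ∫⁻ x, gammaPDF a 1 x * (gammaPDF b 1 (w - x) * f x (w - x)) := by
        refine lintegral_lintegral_swap (Measurable.aemeasurable ?_)
        exact (hga.comp (by fun_prop)).mul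
          ((hgb.comp (by fun_prop)).mul (hf' (by fun_prop) (by fun_prop)))
    _ = ∫⁻ w, ∫⁻ p, betaPDF a b p * (gammaPDF (a + b) 1 w * f (w * p) (w * (1 - p))) := by
        refine lintegral_congr_ae ?_
        filter_upwards [Measure.ae_ne volume (0 : ℝ)] with w hw
        rcases lt_or_gt_of_ne hw with hw | hw
        -- A negative total forces `x` or `w - x` to be negative, so both integrands vanish.
        · rw [gammaPDF_of_neg hw]
          simp only [zero_mul, mul_zero, lintegral_zero]
          refine (lintegral_congr fun x => ?_).trans lintegral_zero
          rcases lt_or_ge x 0 with hx | hx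
          · simp [gammaPDF_of_neg hx]
          · simp [gammaPDF_of_neg (show w - x < 0 by linarith)]
        · rw [lintegral_eq_lintegral_comp_mul_left
            (fun x => gammaPDF a 1 x * (gammaPDF b 1 (w - x) * f x (w - x))) (hga.mul
            ((hgb.comp (by fun_prop)).mul (hf' (by fun_prop) (by fun_prop)))) hw]
          refine lintegral_congr_ae ?_
          filter_upwards [Measure.ae_ne volume (0 : ℝ), Measure.ae_ne volume (1 : ℝ)]
            with p h0 h1
          rw [← mul_assoc (betaPDF a b p), ← gammaPDF_mul_gammaPDF ha hb hw h0 h1,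
            show w - w * p = w * (1 - p) by ring]
          simp only [mul_assoc]
    _ = ∫⁻ p, ∫⁻ w, betaPDF a b p * (gammaPDF (a + b) 1 w * f (w * p) (w * (1 - p))) := by
        refine lintegral_lintegral_swap (Measurable.aemeasurable ?_)
        exact (hbe.comp (by fun_prop)).mul
          ((hgab.comp (by fun_prop)).mul (hf' (by fun_prop) (by fun_prop)))
    _ = _ := by
        refine lintegral_congr fun p => ?_
        rw [lintegral_gammaMeasure _ _ (hf' (by fun_prop) (by fun_prop)), lintegral_const_mul]
        exact hgab.mul (hf' (by fun_prop) (by fun_prop))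

/-- Two ways of cutting a `Dirichlet(a, b, c)` vector into independent beta fractions. -/
theorem lintegral_betaMeasure_betaMeasure {a b c : ℝ} (ha : 0 < a) (hb : 0 < b) (hc : 0 < c)
    {k : ℝ → ℝ → ℝ≥0∞} (hk : Measurable (Function.uncurry k)) :
    ∫⁻ p, ∫⁻ v, k (p * v) (p * (1 - v)) ∂betaMeasure a b ∂betaMeasure (a + b) c =
      ∫⁻ v, ∫⁻ p, k v ((1 - v) * p) ∂betaMeasure b c ∂betaMeasure a (b + c) := by
  have hk' : ∀ {γ : Type} [MeasurableSpace γ] {u v : γ → ℝ}, Measurable u → Measurable v →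
      Measurable fun c => k (u c) (v c) := fun hu hv => hk.comp (hu.prodMk hv)
  have iab := isProbabilityMeasureBeta ha hb
  have ibc := isProbabilityMeasureBeta hb hc
  have iab_c := isProbabilityMeasureBeta (add_pos ha hb) hc
  have ia := isProbabilityMeasure_gammaMeasure ha one_pos
  have ib := isProbabilityMeasure_gammaMeasure hb one_pos
  have ic := isProbabilityMeasure_gammaMeasure hc one_pos
  have ig2 := isProbabilityMeasure_gammaMeasure (add_pos ha hb) one_pos
  have ig3 := isProbabilityMeasure_gammaMeasure (add_pos hb hc) one_pos
  have ig := isProbabilityMeasure_gammaMeasure (add_pos (add_pos ha hb) hc) one_pos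
  have ig' := isProbabilityMeasure_gammaMeasure (add_pos ha (add_pos hb hc)) one_pos
  have hpos : ∀ᵐ w ∂gammaMeasure (a + b + c) 1, w ≠ 0 :=
    (ae_gammaMeasure_pos _ _).mono fun _ h => h.ne'
  have hpos' : ∀ᵐ w ∂gammaMeasure (a + (b + c)) 1, w ≠ 0 :=
    (ae_gammaMeasure_pos _ _).mono fun _ h => h.ne'
  -- Both sides describe three independent gamma variables divided by their sum: the left groups x
  -- with y first, the right y with z. The total cancels because it is almost surely nonzero.
  trans ∫⁻ x, ∫⁻ y, ∫⁻ z, k (x / (x + y + z)) (y / (x + y + z))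
      ∂gammaMeasure c 1 ∂gammaMeasure b 1 ∂gammaMeasure a 1
  · rw [lintegral_gammaMeasure_gammaMeasure ha hb
      (f := fun x y => ∫⁻ z, k (x / (x + y + z)) (y / (x + y + z)) ∂gammaMeasure c 1)
      (Measurable.lintegral_prod_right'
        (f := fun q : (ℝ × ℝ) × ℝ => k (q.1.1 / (q.1.1 + q.1.2 + q.2))
          (q.1.2 / (q.1.1 + q.1.2 + q.2))) (hk' (by fun_prop) (by fun_prop)))]
    rw [lintegral_lintegral_swap (f := fun p v => k (p * v) (p * (1 - v)))
      (hk' (γ := ℝ × ℝ) (by fun_prop) (by fun_prop)).aemeasurable]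
    refine lintegral_congr fun v => ?_
    rw [lintegral_gammaMeasure_gammaMeasure (add_pos ha hb) hc
      (f := fun w z => k (w * v / (w * v + w * (1 - v) + z))
        (w * (1 - v) / (w * v + w * (1 - v) + z))) (hk' (by fun_prop) (by fun_prop))]
    refine lintegral_congr fun p => ?_
    have : ∀ᵐ w ∂gammaMeasure (a + b + c) 1,
        k (w * p * v / (w * p * v + w * p * (1 - v) + w * (1 - p)))
          (w * p * (1 - v) / (w * p * v + w * p * (1 - v) + w * (1 - p))) =
        k (p * v) (p * (1 - v)) := by
      filter_upwards [hpos] with w hw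
      rw [show w * p * v + w * p * (1 - v) + w * (1 - p) = w by ring,
        mul_assoc, mul_div_cancel_left₀ _ hw, mul_assoc, mul_div_cancel_left₀ _ hw]
    rw [lintegral_congr_ae this, lintegral_const, measure_univ, mul_one]
  · have step : ∀ x, ∫⁻ y, ∫⁻ z, k (x / (x + y + z)) (y / (x + y + z))
        ∂gammaMeasure c 1 ∂gammaMeasure b 1 =
        ∫⁻ p, ∫⁻ w, k (x / (x + w)) (w * p / (x + w)) ∂gammaMeasure (b + c) 1
          ∂betaMeasure b c := by
      intro x
      rw [lintegral_gammaMeasure_gammaMeasure hb hc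
        (f := fun y z => k (x / (x + y + z)) (y / (x + y + z)))
        (hk' (by fun_prop) (by fun_prop))]
      refine lintegral_congr fun p => lintegral_congr fun w => ?_
      rw [show x + w * p + w * (1 - p) = x + w by ring]
    simp_rw [step]
    rw [lintegral_lintegral_swap (Measurable.aemeasurable (Measurable.lintegral_prod_right'
        (f := fun q : (ℝ × ℝ) × ℝ => k (q.1.1 / (q.1.1 + q.2)) (q.2 * q.1.2 / (q.1.1 + q.2)))
        (hk' (by fun_prop) (by fun_prop))))]
    have ibab := isProbabilityMeasureBeta ha (add_pos hb hc)
    rw [lintegral_lintegral_swap (μ := betaMeasure a (b + c)) (f := fun v p => k v ((1 - v) * p))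
      (hk' (γ := ℝ × ℝ) (by fun_prop) (by fun_prop)).aemeasurable]
    refine lintegral_congr fun p => ?_
    rw [lintegral_gammaMeasure_gammaMeasure ha (add_pos hb hc)
      (f := fun x w => k (x / (x + w)) (w * p / (x + w))) (hk' (by fun_prop) (by fun_prop))]
    refine lintegral_congr fun v => ?_
    have : ∀ᵐ w ∂gammaMeasure (a + (b + c)) 1,
        k (w * v / (w * v + w * (1 - v))) (w * (1 - v) * p / (w * v + w * (1 - v))) =
        k v ((1 - v) * p) := by
      filter_upwards [hpos'] with w hw
      rw [show w * v + w * (1 - v) = w by ring,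
        mul_div_cancel_left₀ _ hw, mul_assoc, mul_div_cancel_left₀ _ hw]
    rw [lintegral_congr_ae this, lintegral_const, measure_univ, mul_one]

theorem betaPDF_one_sub (a b x : ℝ) : betaPDF a b (1 - x) = betaPDF b a x := by
  have : beta a b = beta b a := by rw [beta, beta, mul_comm, add_comm]
  rw [betaPDF_eq, betaPDF_eq, this]
  by_cases h : 0 < x ∧ x < 1
  · rw [if_pos h, if_pos ⟨by linarith [h.2], by linarith [h.1]⟩, sub_sub_cancel]
    congr 1; ring
  · rw [if_neg h, if_neg (fun h' => h ⟨by linarith [h'.2], by linarith [h'.1]⟩)]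

/-- The reflection `v ↦ 1 - v` exchanges the parameters of a beta distribution. -/
theorem lintegral_betaMeasure_one_sub (a b : ℝ) {g : ℝ → ℝ≥0∞} (hg : Measurable g) :
    ∫⁻ v, g (1 - v) ∂betaMeasure a b = ∫⁻ v, g v ∂betaMeasure b a := by
  rw [lintegral_betaMeasure _ _ (by fun_prop), lintegral_betaMeasure _ _ hg,
    ← lintegral_sub_left_eq_self _ (1 : ℝ)]
  exact lintegral_congr fun v => by rw [betaPDF_one_sub, sub_sub_cancel]

/-- Size-biasing a `beta(a, b)` variable gives a `beta(a + 1, b)` variable. -/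
theorem lintegral_ofReal_mul_betaMeasure {a b : ℝ} (ha : 0 < a) (hb : 0 < b) {g : ℝ → ℝ≥0∞}
    (hg : Measurable g) :
    ∫⁻ v, ENNReal.ofReal v * g v ∂betaMeasure a b =
      ENNReal.ofReal (a / (a + b)) * ∫⁻ v, g v ∂betaMeasure (a + 1) b := by
  rw [lintegral_betaMeasure _ _ (by fun_prop), lintegral_betaMeasure _ _ hg,
    ← lintegral_const_mul _ (by fun_prop)]
  refine lintegral_congr fun v => ?_
  rw [← mul_assoc, ← mul_assoc]
  congr 1
  rcases le_or_gt v 0 with h0 | h0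
  · simp [betaPDF_eq_zero_of_nonpos h0]
  rcases le_or_gt 1 v with h1 | h1
  · simp [betaPDF_eq_zero_of_one_le h1]
  have hq : 0 < 1 - v := by linarith
  have hGa := Real.Gamma_pos_of_pos ha
  have hGb := Real.Gamma_pos_of_pos hb
  have hGab := Real.Gamma_pos_of_pos (add_pos ha hb)
  have hB := beta_pos ha hb
  rw [betaPDF_of_pos_lt_one h0 h1, betaPDF_of_pos_lt_one h0 h1,
    ← ENNReal.ofReal_mul (by positivity), ← ENNReal.ofReal_mul (by positivity)]
  congr 1
  have e1 : v ^ (a + 1 - 1) = v * v ^ (a - 1) := by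
    rw [← Real.rpow_one_add' h0.le (by linarith)]
    congr 1; ring
  rw [e1, beta, beta, show a + 1 + b = a + b + 1 by ring, Real.Gamma_add_one ha.ne',
    Real.Gamma_add_one (add_pos ha hb).ne']
  field_simp

theorem lintegral_ofReal_one_sub_betaMeasure {a b : ℝ} (ha : 0 < a) (hb : 0 < b) :
    ∫⁻ v, ENNReal.ofReal (1 - v) ∂betaMeasure a b = ENNReal.ofReal (b / (a + b)) := by
  have := isProbabilityMeasureBeta (add_pos hb one_pos) ha
  rw [lintegral_betaMeasure_one_sub _ _ ENNReal.measurable_ofReal]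
  have h := lintegral_ofReal_mul_betaMeasure hb ha (g := fun _ => 1) measurable_const
  simp only [mul_one, lintegral_const, measure_univ] at h
  rw [h, add_comm]

/-- Size-biased decomposition of a beta integral. -/
theorem lintegral_betaMeasure_eq_add {a b : ℝ} (ha : 0 < a) (hb : 0 < b) {g : ℝ → ℝ≥0∞}
    (hg : Measurable g) :
    ∫⁻ v, g v ∂betaMeasure a b =
      ENNReal.ofReal (a / (a + b)) * ∫⁻ v, g v ∂betaMeasure (a + 1) b +
      ENNReal.ofReal (b / (a + b)) * ∫⁻ v, g (1 - v) ∂betaMeasure (b + 1) a := by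
  have hg' : Measurable fun v : ℝ => g (1 - v) := hg.comp (by fun_prop)
  rw [← lintegral_ofReal_mul_betaMeasure ha hb hg, add_comm a b,
    ← lintegral_ofReal_mul_betaMeasure hb ha hg',
    ← lintegral_betaMeasure_one_sub _ _ (by fun_prop : Measurable fun v : ℝ =>
      ENNReal.ofReal v * g (1 - v)),
    ← lintegral_add_left (by fun_prop)]
  -- The two size-biased terms recombine through v + (1 - v) = 1.
  refine lintegral_congr_ae ?_
  filter_upwards [ae_betaMeasure_mem_Ioo a b] with v hv
  rw [sub_sub_cancel, ← add_mul, ← ENNReal.ofReal_add hv.1.le (by linarith [hv.2])]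
  simp

/-! ### Stick-breaking recursion -/

variable {I : Type*} [MeasurableSpace I]

@[fun_prop]
theorem measurable_smul_measure {β : Type*} [MeasurableSpace β] {f : β → ℝ≥0∞}
    {g : β → Measure I} (hf : Measurable f) (hg : Measurable g) :
    Measurable fun b => f b • g b := by
  refine Measure.measurable_of_measurable_coe _ fun s hs => ?_
  simp only [Measure.smul_apply, smul_eq_mul]
  exact hf.mul ((Measure.measurable_coe hs).comp hg)

/-- The combination `v ν + (1 - v) ν'` of two measures. -/
noncomputable def mix (v : ℝ) (ν ν' : Measure I) : Measure I :=
  ENNReal.ofReal v • ν + ENNReal.ofReal (1 - v) • ν'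

@[fun_prop]
theorem measurable_mix {β : Type*} [MeasurableSpace β] {v : β → ℝ} {f g : β → Measure I}
    (hv : Measurable v) (hf : Measurable f) (hg : Measurable g) :
    Measurable fun b => mix (v b) (f b) (g b) := by
  unfold mix
  fun_prop

@[fun_prop]
theorem measurable_dirac_comp {β : Type*} [MeasurableSpace β] {z : β → I} (hz : Measurable z) :
    Measurable fun b => Measure.dirac (z b) :=
  Measure.measurable_dirac.comp hz

@[fun_prop]
theorem measurable_stickBreaking_comp {β : Type*} [MeasurableSpace β] {v : β → ℕ → ℝ}
    {z : β → ℕ → I} (hv : Measurable v) (hz : Measurable z) :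
    Measurable fun b => stickBreaking (v b) (z b) :=
  Measurable.comp (f := fun b => (v b, z b)) (measurable_stickBreaking (I := I)) (hv.prodMk hz)

/-- Prepend a term to a sequence. -/
def consSeq {X : Type*} (x : X) (f : ℕ → X) : ℕ → X
  | 0 => x
  | k + 1 => f k

@[fun_prop]
theorem measurable_consSeq {X β : Type*} [MeasurableSpace X] [MeasurableSpace β] {x : β → X}
    {f : β → ℕ → X} (hx : Measurable x) (hf : Measurable f) :
    Measurable fun b => consSeq (x b) (f b) := by
  refine measurable_pi_iff.2 fun k => ?_
  cases k with
  | zero => exact hx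
  | succ k => exact (measurable_pi_apply k).comp hf

/-- Separates the head of an independent sequence from its tail. A product measure is determined on
finite boxes, and the preimage of a box over an initial segment is a product. -/
theorem infinitePi_eq_map_consSeq {X : Type*} [MeasurableSpace X] (μ : ℕ → Measure X)
    [∀ k, IsProbabilityMeasure (μ k)] :
    Measure.infinitePi μ =
      ((μ 0).prod (Measure.infinitePi fun k => μ (k + 1))).map fun p => consSeq p.1 p.2 := by
  refine (Measure.eq_infinitePi μ fun s t ht => ?_).symm
  classical
  obtain ⟨N, hN⟩ : ∃ N, s ⊆ Finset.range (N + 1) :=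
    ⟨s.sup id, fun i hi => Finset.mem_range_succ_iff.2 (Finset.le_sup (f := id) hi)⟩
  -- Padding with `univ` replaces the arbitrary index set `s` by an initial segment.
  set t' : ℕ → Set X := fun i => if i ∈ s then t i else Set.univ with ht'
  have mt' : ∀ i, MeasurableSet (t' i) := fun i => by
    by_cases h : i ∈ s <;> simp [ht', h, ht]
  have hset : Set.pi (s : Set ℕ) t = Set.pi (Finset.range (N + 1) : Set ℕ) t' := by
    ext f
    simp only [Set.mem_pi, Finset.mem_coe, ht']
    refine ⟨fun h i _ => ?_, fun h i hi => by simpa [hi] using h i (hN hi)⟩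
    by_cases hi : i ∈ s <;> simp [hi, h]
  have hprod : ∏ i ∈ s, μ i (t i) = ∏ i ∈ Finset.range (N + 1), μ i (t' i) := by
    rw [← Finset.prod_subset hN (f := fun i => μ i (t' i))]
    · exact Finset.prod_congr rfl fun i hi => by simp [ht', hi]
    · intro i _ hi
      simp [ht', hi]
  have hpre : (fun p : X × (ℕ → X) => consSeq p.1 p.2) ⁻¹'
      Set.pi (Finset.range (N + 1) : Set ℕ) t' =
      t' 0 ×ˢ Set.pi (Finset.range N : Set ℕ) fun k => t' (k + 1) := by
    ext p
    simp only [Set.mem_preimage, Set.mem_pi, Set.mem_prod, Finset.mem_coe, Finset.mem_range]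
    refine ⟨fun h => ⟨h 0 (by omega), fun k hk => h (k + 1) (by omega)⟩, fun h i hi => ?_⟩
    cases i with
    | zero => exact h.1
    | succ k => exact h.2 k (by omega)
  rw [hset, hprod, Measure.map_apply (by fun_prop)
    (MeasurableSet.pi (Finset.countable_toSet _) fun i _ => mt' i), hpre, Measure.prod_prod,
    Measure.infinitePi_pi _ fun i _ => mt' (i + 1), Finset.prod_range_succ', mul_comm]

theorem weight_consSeq_succ (v₀ : ℝ) (v : ℕ → ℝ) (k : ℕ) :
    weight (consSeq v₀ v) (k + 1) = (1 - v₀) * weight v k := by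
  simp only [weight, Finset.prod_range_succ', consSeq]
  ring

theorem stickBreaking_consSeq {v₀ : ℝ} (h : v₀ ≤ 1) (v : ℕ → ℝ) (z₀ : I) (z : ℕ → I) :
    stickBreaking (consSeq v₀ v) (consSeq z₀ z) =
      mix v₀ (Measure.dirac z₀) (stickBreaking v z) := by
  ext s hs
  simp only [stickBreaking, mix, Measure.sum_apply _ hs, Measure.add_apply, Measure.smul_apply,
    smul_eq_mul]
  rw [tsum_eq_zero_add' ENNReal.summable, ← ENNReal.tsum_mul_left]
  congr 1
  · simp [weight, consSeq]
  · refine tsum_congr fun k => ?_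
    rw [weight_consSeq_succ, ENNReal.ofReal_mul (by linarith), mul_assoc]
    rfl

theorem sum_weight (v : ℕ → ℝ) (n : ℕ) :
    ∑ k ∈ Finset.range n, weight v k = 1 - ∏ j ∈ Finset.range n, (1 - v j) := by
  induction n with
  | zero => simp
  | succ n ih => rw [Finset.sum_range_succ, ih, Finset.prod_range_succ, weight]; ring

/-- The partial sums of the weights telescope. The bound is enough for the Lipschitz argument; total
mass one enters only in the final normalization. -/
theorem stickBreaking_univ_le_one {v : ℕ → ℝ} (hv : ∀ k, v k ∈ Set.Icc (0 : ℝ) 1) (z : ℕ → I) :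
    stickBreaking v z Set.univ ≤ 1 := by
  have hprod : ∀ n, 0 ≤ ∏ j ∈ Finset.range n, (1 - v j) := fun n =>
    Finset.prod_nonneg fun j _ => by linarith [(hv j).2]
  simp only [stickBreaking, Measure.sum_apply _ MeasurableSet.univ, Measure.smul_apply,
    smul_eq_mul, measure_univ, mul_one]
  refine ENNReal.tsum_le_of_sum_range_le fun n => ?_
  rw [← ENNReal.ofReal_sum_of_nonneg (f := weight v) fun k _ => mul_nonneg (hv k).1 (hprod k),
    sum_weight]
  exact ENNReal.ofReal_le_one.2 (by linarith [hprod n])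

theorem isProbabilityMeasure_fraction {α : ℝ} (hα0 : 0 < α) (hα1 : α < 1) {t : ℝ} (ht : 0 < t)
    (k : ℕ) :
    IsProbabilityMeasure (betaMeasure (1 - α) (t + ((k : ℝ) + 1) * α)) :=
  isProbabilityMeasureBeta (by linarith) (by positivity)

theorem isProbabilityMeasure_law_of_pos {α : ℝ} (hα0 : 0 < α) (hα1 : α < 1) {t : ℝ} (ht : 0 < t)
    (H : Measure I) [IsProbabilityMeasure H] :
    IsProbabilityMeasure (law α t H) :=
  isProbabilityMeasure_law hα0.le hα1 (by linarith) H

theorem isProbabilityMeasure_fractionLaw {α : ℝ} (hα0 : 0 < α) (hα1 : α < 1) {t : ℝ} (ht : 0 < t) :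
    IsProbabilityMeasure (fractionLaw α t) := by
  have := isProbabilityMeasure_fraction hα0 hα1 ht
  unfold fractionLaw
  infer_instance

theorem ae_fractionLaw_mem_Icc {α : ℝ} (hα0 : 0 < α) (hα1 : α < 1) {t : ℝ} (ht : 0 < t) :
    ∀ᵐ v ∂fractionLaw α t, ∀ k, v k ∈ Set.Icc (0 : ℝ) 1 := by
  have := isProbabilityMeasure_fraction hα0 hα1 ht
  refine ae_all_iff.2 fun k => ?_
  have h := (measurePreserving_eval_infinitePi
    (fun k : ℕ => betaMeasure (1 - α) (t + ((k : ℝ) + 1) * α)) k).quasiMeasurePreserving.ae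
    (ae_betaMeasure_mem_Ioo _ _)
  exact h.mono fun v hv => Set.Ioo_subset_Icc_self hv

theorem ae_law_univ_le_one {α : ℝ} (hα0 : 0 < α) (hα1 : α < 1) {t : ℝ} (ht : 0 < t)
    (H : Measure I) : ∀ᵐ ν ∂law α t H, ν Set.univ ≤ 1 := by
  have := isProbabilityMeasure_fractionLaw hα0 hα1 ht
  rw [law, ae_map_iff measurable_stickBreaking.aemeasurable
    (measurableSet_le (Measure.measurable_coe MeasurableSet.univ) measurable_const)]
  filter_upwards [Measure.quasiMeasurePreserving_fst.ae (ae_fractionLaw_mem_Icc hα0 hα1 ht)]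
    with p hp using stickBreaking_univ_le_one hp _

theorem lintegral_law {α : ℝ} (hα0 : 0 < α) (hα1 : α < 1) {t : ℝ} (ht : 0 < t)
    (H : Measure I) [IsProbabilityMeasure H]
    {F : Measure I → ℝ≥0∞} (hF : Measurable F) :
    ∫⁻ ν, F ν ∂law α t H = ∫⁻ v, ∫⁻ z, F (stickBreaking v z)
      ∂Measure.infinitePi (fun _ : ℕ => H) ∂fractionLaw α t := by
  have := isProbabilityMeasure_fractionLaw hα0 hα1 ht
  rw [law, lintegral_map hF measurable_stickBreaking,
    lintegral_prod _ (Measurable.aemeasurable (by fun_prop))]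

/-- Shifting the index by one amounts to replacing t by t + α, since t + (k + 2)α = (t + α) + (k +
1)α. -/
theorem fractionLaw_eq_map_consSeq {α : ℝ} (hα0 : 0 < α) (hα1 : α < 1) {t : ℝ} (ht : 0 < t) :
    fractionLaw α t = ((betaMeasure (1 - α) (t + α)).prod (fractionLaw α (t + α))).map
      fun p => consSeq p.1 p.2 := by
  have := isProbabilityMeasure_fraction hα0 hα1 ht
  rw [fractionLaw, infinitePi_eq_map_consSeq, fractionLaw]
  congr 3
  · norm_num
  · ext1 k
    push_cast
    ring_nf

/-- The one-step stick-breaking recursion: if `P` has law `Π_{α,t+α}`, `V ~ beta(1 - α, t + α)`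
and `Z ~ H`, all independent, then `V δ_Z + (1 - V) P` has law `Π_{α,t}`. -/
theorem lintegral_law_eq_stick {α : ℝ} (hα0 : 0 < α) (hα1 : α < 1) {t : ℝ} (ht : 0 < t)
    (H : Measure I) [IsProbabilityMeasure H]
    {F : Measure I → ℝ≥0∞} (hF : Measurable F) :
    ∫⁻ ν, F ν ∂law α t H =
      ∫⁻ v, ∫⁻ z, ∫⁻ ν, F (mix v (Measure.dirac z) ν) ∂law α (t + α) H ∂H
        ∂betaMeasure (1 - α) (t + α) := by
  have hta : 0 < t + α := by linarith
  have := isProbabilityMeasure_fractionLaw hα0 hα1 hta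
  have := isProbabilityMeasureBeta (show 0 < 1 - α by linarith) hta
  rw [lintegral_law hα0 hα1 ht H hF, fractionLaw_eq_map_consSeq hα0 hα1 ht,
    lintegral_map (Measurable.lintegral_prod_right (by unfold Function.uncurry; fun_prop))
      (by fun_prop),
    lintegral_prod _ (Measurable.aemeasurable
      (Measurable.lintegral_prod_right (by unfold Function.uncurry; fun_prop)))]
  refine lintegral_congr_ae ?_
  filter_upwards [ae_betaMeasure_mem_Ioo (1 - α) (t + α)] with v₀ hv₀
  calc ∫⁻ v, ∫⁻ z, F (stickBreaking (consSeq v₀ v) z) ∂Measure.infinitePi (fun _ : ℕ => H)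
        ∂fractionLaw α (t + α)
      = ∫⁻ v, ∫⁻ z₀, ∫⁻ z, F (mix v₀ (Measure.dirac z₀) (stickBreaking v z))
          ∂Measure.infinitePi (fun _ : ℕ => H) ∂H ∂fractionLaw α (t + α) := by
        refine lintegral_congr fun v => ?_
        conv_lhs => rw [infinitePi_eq_map_consSeq, lintegral_map (by fun_prop) (by fun_prop),
          lintegral_prod _ (Measurable.aemeasurable (by fun_prop))]
        simp only [stickBreaking_consSeq hv₀.2.le]
    _ = ∫⁻ z₀, ∫⁻ v, ∫⁻ z, F (mix v₀ (Measure.dirac z₀) (stickBreaking v z))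
          ∂Measure.infinitePi (fun _ : ℕ => H) ∂fractionLaw α (t + α) ∂H :=
        lintegral_lintegral_swap (Measurable.aemeasurable
          (Measurable.lintegral_prod_right (by unfold Function.uncurry; fun_prop)))
    _ = _ := by
        refine lintegral_congr fun z₀ => ?_
        rw [lintegral_law hα0 hα1 hta H (by fun_prop)]

/-! ### A recursion shared by mixtures and Poisson–Dirichlet laws -/

/-- The law of `B P + (1 - B) P'`, where `B ~ beta(t, s)`, `P ~ Π_{α,t}` and `P' ~ Π_{α,s}` are
independent. -/
noncomputable def mixLaw (α t s : ℝ) (H : Measure I) : Measure (Measure I) :=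
  ((betaMeasure t s).prod ((law α t H).prod (law α s H))).map fun p => mix p.1 p.2.1 p.2.2

/-- The operator `F ↦ E F(V δ_Z + (1 - V) ν)` with `V ~ beta(1 - α, u + α)` and `Z ~ H`. -/
noncomputable def stick (α u : ℝ) (H : Measure I) (F : Measure I → ℝ≥0∞) (ν : Measure I) : ℝ≥0∞ :=
  ∫⁻ v, ∫⁻ z, F (mix v (Measure.dirac z) ν) ∂H ∂betaMeasure (1 - α) (u + α)

theorem mix_comm (b : ℝ) (ν ν' : Measure I) : mix (1 - b) ν' ν = mix b ν ν' := by
  rw [mix, mix, sub_sub_cancel, add_comm]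

/-- This and `mix_mix_right` bring two nested mixtures to a common form whose third coefficient is
one minus the other two, so that Dirichlet recutting can be applied to the coefficients. -/
theorem mix_mix_left {b v : ℝ} (hb : b ∈ Set.Ioo (0 : ℝ) 1) (ξ ν ν' : Measure I) :
    mix b (mix v ξ ν) ν' =
      ENNReal.ofReal (b * v) • ξ + ENNReal.ofReal (b * (1 - v)) • ν +
        ENNReal.ofReal (1 - b * v - b * (1 - v)) • ν' := by
  rw [mix, mix, smul_add, smul_smul, smul_smul, ← ENNReal.ofReal_mul hb.1.le,
    ← ENNReal.ofReal_mul hb.1.le, show 1 - b * v - b * (1 - v) = 1 - b by ring]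

theorem mix_mix_right {b v : ℝ} (hv : v ∈ Set.Ioo (0 : ℝ) 1) (ξ ν ν' : Measure I) :
    mix v ξ (mix b ν ν') =
      ENNReal.ofReal v • ξ + ENNReal.ofReal ((1 - v) * b) • ν +
        ENNReal.ofReal (1 - v - (1 - v) * b) • ν' := by
  have h : 0 ≤ 1 - v := by linarith [hv.2]
  rw [mix, mix, smul_add, smul_smul, smul_smul, ← ENNReal.ofReal_mul h,
    ← ENNReal.ofReal_mul h, show 1 - v - (1 - v) * b = (1 - v) * (1 - b) by ring, add_assoc]

theorem measurable_stick {α : ℝ} (hα1 : α < 1) {t : ℝ} (H : Measure I) [IsProbabilityMeasure H]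
    (hu : 0 < t + α) {F : Measure I → ℝ≥0∞} (hF : Measurable F) :
    Measurable (stick α t H F) := by
  have := isProbabilityMeasureBeta (show 0 < 1 - α by linarith) hu
  refine Measurable.lintegral_prod_right ?_
  exact Measurable.lintegral_prod_right (f := fun (q : Measure I × ℝ) z =>
    F (mix q.2 (Measure.dirac z) q.1)) (by unfold Function.uncurry; fun_prop)

theorem lintegral_law_eq_lintegral_stick {α : ℝ} (hα0 : 0 < α) (hα1 : α < 1) {t : ℝ}
    (H : Measure I) [IsProbabilityMeasure H] (ht : 0 < t) {F : Measure I → ℝ≥0∞}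
    (hF : Measurable F) :
    ∫⁻ ν, F ν ∂law α t H = ∫⁻ ν, stick α t H F ν ∂law α (t + α) H := by
  have hta : 0 < t + α := by linarith
  have := isProbabilityMeasureBeta (show 0 < 1 - α by linarith) hta
  have := isProbabilityMeasure_law_of_pos hα0 hα1 hta H
  rw [lintegral_law_eq_stick hα0 hα1 ht H hF]
  unfold stick
  rw [lintegral_lintegral_swap (f := fun ν v => ∫⁻ z, F (mix v (Measure.dirac z) ν) ∂H)]
  · refine lintegral_congr fun v => ?_
    rw [lintegral_lintegral_swap]
    exact Measurable.aemeasurable (by unfold Function.uncurry; fun_prop)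
  · exact Measurable.aemeasurable (Measurable.lintegral_prod_right (f :=
      fun (q : Measure I × ℝ) z => F (mix q.2 (Measure.dirac z) q.1))
      (by unfold Function.uncurry; fun_prop))

theorem isProbabilityMeasure_mixLaw {α : ℝ} (hα0 : 0 < α) (hα1 : α < 1) {t s : ℝ}
    (ht : 0 < t) (hs : 0 < s) (H : Measure I) [IsProbabilityMeasure H] :
    IsProbabilityMeasure (mixLaw α t s H) := by
  have := isProbabilityMeasureBeta ht hs
  have := isProbabilityMeasure_law_of_pos hα0 hα1 ht H
  have := isProbabilityMeasure_law_of_pos hα0 hα1 hs H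
  exact Measure.isProbabilityMeasure_map (Measurable.aemeasurable (by fun_prop))

theorem ae_mixLaw_univ_le_one {α : ℝ} (hα0 : 0 < α) (hα1 : α < 1) {t s : ℝ}
    (ht : 0 < t) (hs : 0 < s) (H : Measure I) [IsProbabilityMeasure H] :
    ∀ᵐ ν ∂mixLaw α t s H, ν Set.univ ≤ 1 := by
  have := isProbabilityMeasureBeta ht hs
  have := isProbabilityMeasure_law_of_pos hα0 hα1 ht H
  have := isProbabilityMeasure_law_of_pos hα0 hα1 hs H
  rw [mixLaw, ae_map_iff (Measurable.aemeasurable (by fun_prop))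
    (measurableSet_le (Measure.measurable_coe MeasurableSet.univ) measurable_const)]
  filter_upwards [Measure.quasiMeasurePreserving_fst.ae (ae_betaMeasure_mem_Ioo t s),
    Measure.quasiMeasurePreserving_snd.ae (Measure.quasiMeasurePreserving_fst.ae
      (ae_law_univ_le_one hα0 hα1 ht H)),
    Measure.quasiMeasurePreserving_snd.ae (Measure.quasiMeasurePreserving_snd.ae
      (ae_law_univ_le_one hα0 hα1 hs H))] with p h1 h2 h3
  have h4 : 0 ≤ 1 - p.1 := by linarith [h1.2]
  calc mix p.1 p.2.1 p.2.2 Set.univ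
      = ENNReal.ofReal p.1 * p.2.1 Set.univ + ENNReal.ofReal (1 - p.1) * p.2.2 Set.univ := rfl
    _ ≤ ENNReal.ofReal p.1 * 1 + ENNReal.ofReal (1 - p.1) * 1 := by gcongr
    _ = 1 := by rw [mul_one, mul_one, ← ENNReal.ofReal_add h1.1.le h4]; simp

theorem lintegral_mixLaw {α : ℝ} (hα0 : 0 < α) (hα1 : α < 1) {t s : ℝ}
    (ht : 0 < t) (hs : 0 < s) (H : Measure I) [IsProbabilityMeasure H]
    {F : Measure I → ℝ≥0∞} (hF : Measurable F) :
    ∫⁻ ν, F ν ∂mixLaw α t s H =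
      ∫⁻ b, ∫⁻ ν, ∫⁻ ν', F (mix b ν ν') ∂law α s H ∂law α t H ∂betaMeasure t s := by
  have := isProbabilityMeasureBeta ht hs
  have := isProbabilityMeasure_law_of_pos hα0 hα1 ht H
  have := isProbabilityMeasure_law_of_pos hα0 hα1 hs H
  rw [mixLaw, lintegral_map hF (by fun_prop),
    lintegral_prod _ (Measurable.aemeasurable (by fun_prop))]
  refine lintegral_congr fun b => ?_
  rw [lintegral_prod _ (Measurable.aemeasurable (by fun_prop))]

/-- Breaking a stick off the first component of a mixture whose weight has been size-biased. -/
theorem lintegral_sizeBiased_mix {α : ℝ} (hα0 : 0 < α) (hα1 : α < 1) {t s : ℝ}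
    (ht : 0 < t) (hs : 0 < s) (H : Measure I) [IsProbabilityMeasure H]
    {F : Measure I → ℝ≥0∞} (hF : Measurable F) :
    ∫⁻ b, ∫⁻ ν, ∫⁻ ν', F (mix b ν ν') ∂law α s H ∂law α t H ∂betaMeasure (t + 1) s =
      ∫⁻ ν, stick α (t + s) H F ν ∂mixLaw α (t + α) s H := by
  have hta : 0 < t + α := by linarith
  have h1α : 0 < 1 - α := by linarith
  have := isProbabilityMeasureBeta hta hs
  have := isProbabilityMeasureBeta h1α hta
  have := isProbabilityMeasureBeta h1α (show 0 < t + s + α by linarith)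
  have := isProbabilityMeasureBeta (show 0 < t + 1 by linarith) hs
  have := isProbabilityMeasure_law_of_pos hα0 hα1 ht H
  have := isProbabilityMeasure_law_of_pos hα0 hα1 hs H
  have := isProbabilityMeasure_law_of_pos hα0 hα1 hta H
  have := isProbabilityMeasure_mixLaw hα0 hα1 hta hs H
  -- Averaging over the atom and both processes leaves a function of the first two coordinates of a
  -- Dirichlet(1 - α, t + α, s) vector.
  set k : ℝ → ℝ → ℝ≥0∞ := fun x y => ∫⁻ z, ∫⁻ ν, ∫⁻ ν',
    F (ENNReal.ofReal x • Measure.dirac z + ENNReal.ofReal y • ν +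
      ENNReal.ofReal (1 - x - y) • ν') ∂law α s H ∂law α (t + α) H ∂H with hk
  have hkm : Measurable (Function.uncurry k) := by
    refine Measurable.lintegral_prod_right (f := fun (q : ℝ × ℝ) z => ∫⁻ ν, ∫⁻ ν',
      F (ENNReal.ofReal q.1 • Measure.dirac z + ENNReal.ofReal q.2 • ν +
      ENNReal.ofReal (1 - q.1 - q.2) • ν') ∂law α s H ∂law α (t + α) H) ?_
    refine Measurable.lintegral_prod_right (f := fun (q : (ℝ × ℝ) × I) ν => ∫⁻ ν',
      F (ENNReal.ofReal q.1.1 • Measure.dirac q.2 + ENNReal.ofReal q.1.2 • ν +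
      ENNReal.ofReal (1 - q.1.1 - q.1.2) • ν') ∂law α s H) ?_
    refine Measurable.lintegral_prod_right (f := fun (q : ((ℝ × ℝ) × I) × Measure I) ν' =>
      F (ENNReal.ofReal q.1.1.1 • Measure.dirac q.1.2 + ENNReal.ofReal q.1.1.2 • q.2 +
      ENNReal.ofReal (1 - q.1.1.1 - q.1.1.2) • ν')) ?_
    unfold Function.uncurry
    fun_prop
  trans ∫⁻ p, ∫⁻ v, k (p * v) (p * (1 - v)) ∂betaMeasure (1 - α) (t + α)
      ∂betaMeasure (1 - α + (t + α)) s
  -- This identity is why the size-biased weight is needed: only a first parameter `t + 1` fits a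
  -- beta(1 - α, t + α) cut.
  · rw [show 1 - α + (t + α) = t + 1 by ring]
    refine lintegral_congr_ae ?_
    filter_upwards [ae_betaMeasure_mem_Ioo (t + 1) s] with b hb
    rw [lintegral_law_eq_stick hα0 hα1 ht H (F := fun ν => ∫⁻ ν', F (mix b ν ν') ∂law α s H)
      (Measurable.lintegral_prod_right (by unfold Function.uncurry; fun_prop))]
    simp only [mix_mix_left hb, hk]
  · rw [lintegral_betaMeasure_betaMeasure h1α hta hs hkm]
    unfold stick
    rw [lintegral_lintegral_swap (f := fun ν v => ∫⁻ z, F (mix v (Measure.dirac z) ν) ∂H),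
      show t + α + s = t + s + α by ring]
    · refine lintegral_congr_ae ?_
      filter_upwards [ae_betaMeasure_mem_Ioo (1 - α) (t + s + α)] with v hv
      rw [lintegral_lintegral_swap (f := fun ν z => F (mix v (Measure.dirac z) ν))]
      · simp only [hk]
        rw [lintegral_lintegral_swap]
        · refine lintegral_congr fun z => ?_
          rw [lintegral_mixLaw hα0 hα1 hta hs H (by fun_prop)]
          simp only [mix_mix_right hv]
        · refine Measurable.aemeasurable ?_
          refine Measurable.lintegral_prod_right (f := fun (q : ℝ × I) ν => ∫⁻ ν',
            F (ENNReal.ofReal v • Measure.dirac q.2 + ENNReal.ofReal ((1 - v) * q.1) • ν +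
            ENNReal.ofReal (1 - v - (1 - v) * q.1) • ν') ∂law α s H) ?_
          refine Measurable.lintegral_prod_right (f := fun (q : (ℝ × I) × Measure I) ν' =>
            F (ENNReal.ofReal v • Measure.dirac q.1.2 + ENNReal.ofReal ((1 - v) * q.1.1) • q.2 +
            ENNReal.ofReal (1 - v - (1 - v) * q.1.1) • ν')) ?_
          unfold Function.uncurry
          fun_prop
      · exact Measurable.aemeasurable (by unfold Function.uncurry; fun_prop)
    · exact Measurable.aemeasurable (Measurable.lintegral_prod_right (f :=
        fun (q : Measure I × ℝ) z => F (mix q.2 (Measure.dirac z) q.1))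
        (by unfold Function.uncurry; fun_prop))

/-- A mixture loses a stick either from its first or from its second component. -/
theorem lintegral_mixLaw_eq_add {α : ℝ} (hα0 : 0 < α) (hα1 : α < 1) {t s : ℝ}
    (ht : 0 < t) (hs : 0 < s) (H : Measure I) [IsProbabilityMeasure H]
    {F : Measure I → ℝ≥0∞} (hF : Measurable F) :
    ∫⁻ ν, F ν ∂mixLaw α t s H =
      ENNReal.ofReal (t / (t + s)) * ∫⁻ ν, stick α (t + s) H F ν ∂mixLaw α (t + α) s H +
      ENNReal.ofReal (s / (t + s)) * ∫⁻ ν, stick α (t + s) H F ν ∂mixLaw α (s + α) t H := by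
  have := isProbabilityMeasure_law_of_pos hα0 hα1 ht H
  have := isProbabilityMeasure_law_of_pos hα0 hα1 hs H
  rw [← lintegral_sizeBiased_mix hα0 hα1 ht hs H hF, add_comm t s,
    ← lintegral_sizeBiased_mix hα0 hα1 hs ht H hF, add_comm s t,
    lintegral_mixLaw hα0 hα1 ht hs H hF, lintegral_betaMeasure_eq_add ht hs]
  · congr 2
    -- The reflected term is the size-biased one with the two components exchanged.
    refine lintegral_congr fun b => ?_
    rw [lintegral_lintegral_swap (Measurable.aemeasurable
      (by unfold Function.uncurry; fun_prop))]
    simp only [mix_comm]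
  · refine Measurable.lintegral_prod_right (f := fun (b : ℝ) ν => ∫⁻ ν',
      F (mix b ν ν') ∂law α s H) ?_
    exact Measurable.lintegral_prod_right (f := fun (q : ℝ × Measure I) ν' =>
      F (mix q.1 q.2 ν')) (by unfold Function.uncurry; fun_prop)

/-! ### Contraction under stick-breaking -/

/-- A measurable functional on measures which, on sub-probability measures, changes by at most
`c r` when a part of mass `r` is changed. -/
structure IsSubprobLipschitz (c : ℝ≥0∞) (F : Measure I → ℝ≥0∞) : Prop where
  measurable : Measurable F
  le_add : ∀ (r : ℝ≥0∞) (ξ ν ν' : Measure I), ξ Set.univ + r ≤ 1 → ν Set.univ ≤ 1 →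
    ν' Set.univ ≤ 1 → F (ξ + r • ν) ≤ F (ξ + r • ν') + c * r

theorem IsSubprobLipschitz.le_add_const {c : ℝ≥0∞} {F : Measure I → ℝ≥0∞}
    (hF : IsSubprobLipschitz c F) {ν ν' : Measure I} (hν : ν Set.univ ≤ 1)
    (hν' : ν' Set.univ ≤ 1) : F ν ≤ F ν' + c := by
  simpa using hF.le_add 1 0 ν ν' (by simp) hν hν'

theorem IsSubprobLipschitz.lintegral_le {c : ℝ≥0∞} {F : Measure I → ℝ≥0∞}
    (hF : IsSubprobLipschitz c F) {ρ ρ' : Measure (Measure I)} [IsProbabilityMeasure ρ]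
    [IsProbabilityMeasure ρ'] (hρ : ∀ᵐ ν ∂ρ, ν Set.univ ≤ 1) (hρ' : ∀ᵐ ν ∂ρ', ν Set.univ ≤ 1) :
    ∫⁻ ν, F ν ∂ρ ≤ ∫⁻ ν, F ν ∂ρ' + c := by
  have key : ∀ ν : Measure I, ν Set.univ ≤ 1 → F ν ≤ ∫⁻ ν', F ν' ∂ρ' + c := fun ν hν => by
    calc F ν = ∫⁻ _, F ν ∂ρ' := by simp
      _ ≤ ∫⁻ ν', (F ν' + c) ∂ρ' :=
        lintegral_mono_ae (hρ'.mono fun ν' hν' => hF.le_add_const hν hν')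
      _ = ∫⁻ ν', F ν' ∂ρ' + c := by rw [lintegral_add_right _ measurable_const]; simp
  calc ∫⁻ ν, F ν ∂ρ ≤ ∫⁻ _, (∫⁻ ν', F ν' ∂ρ' + c) ∂ρ := lintegral_mono_ae (hρ.mono key)
    _ = _ := by simp

/-- Breaking a stick off ξ + r ν puts the new atom into the unchanged part and shrinks r to (1 - v)
r. Averaging over v replaces the constant c by c E(1 - V). -/
theorem IsSubprobLipschitz.stick {α u : ℝ} (hα1 : α < 1) (hu : 0 < u + α) (H : Measure I)
    [IsProbabilityMeasure H] {c : ℝ≥0∞} {F : Measure I → ℝ≥0∞} (hF : IsSubprobLipschitz c F) :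
    IsSubprobLipschitz (c * ENNReal.ofReal ((u + α) / (u + 1))) (stick α u H F) where
  measurable := measurable_stick hα1 H hu hF.measurable
  le_add r ξ ν ν' hr hν hν' := by
    have h1α : 0 < 1 - α := by linarith
    have := isProbabilityMeasureBeta h1α hu
    have hmix : ∀ (v : ℝ) (z : I) (ν : Measure I), mix v (Measure.dirac z) (ξ + r • ν) =
        (ENNReal.ofReal v • Measure.dirac z + ENNReal.ofReal (1 - v) • ξ) +
          (ENNReal.ofReal (1 - v) * r) • ν := fun v z ν => by
      rw [mix, smul_add, smul_smul, add_assoc]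
    have hle : ∀ v ∈ Set.Ioo (0 : ℝ) 1, ∀ z : I,
        F (mix v (Measure.dirac z) (ξ + r • ν)) ≤
          F (mix v (Measure.dirac z) (ξ + r • ν')) + c * (ENNReal.ofReal (1 - v) * r) := by
      intro v hv z
      rw [hmix, hmix]
      refine hF.le_add _ _ _ _ ?_ hν hν'
      calc (ENNReal.ofReal v • Measure.dirac z + ENNReal.ofReal (1 - v) • ξ) Set.univ +
            ENNReal.ofReal (1 - v) * r
          = ENNReal.ofReal v + ENNReal.ofReal (1 - v) * (ξ Set.univ + r) := by
            simp [mul_add, add_assoc]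
        _ ≤ ENNReal.ofReal v + ENNReal.ofReal (1 - v) * 1 := by gcongr
        _ = 1 := by
            rw [mul_one, ← ENNReal.ofReal_add hv.1.le (by linarith [hv.2])]
            simp
    calc PoissonDirichlet.stick α u H F (ξ + r • ν)
        ≤ ∫⁻ v, (∫⁻ z, F (mix v (Measure.dirac z) (ξ + r • ν')) ∂H +
            c * (ENNReal.ofReal (1 - v) * r)) ∂betaMeasure (1 - α) (u + α) := by
          refine lintegral_mono_ae ?_
          filter_upwards [ae_betaMeasure_mem_Ioo (1 - α) (u + α)] with v hv
          refine (lintegral_mono (hle v hv)).trans_eq ?_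
          rw [lintegral_add_right _ measurable_const]
          simp
      _ = _ := by
          rw [lintegral_add_right _ (by fun_prop), PoissonDirichlet.stick,
            lintegral_const_mul _ (by fun_prop), lintegral_mul_const _ (by fun_prop),
            lintegral_ofReal_one_sub_betaMeasure h1α hu, mul_assoc,
            show 1 - α + (u + α) = u + 1 by ring]

/-- The expectation of `∏ (1 - Vⱼ)` over the first `k` fractions. -/
noncomputable def remainder (α : ℝ) : ℕ → ℝ → ℝ
  | 0, _ => 1
  | k + 1, u => (u + α) / (u + 1) * remainder α k (u + α)

theorem remainder_nonneg {α : ℝ} (hα0 : 0 < α) (k : ℕ) {u : ℝ} (hu : 0 < u) :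
    0 ≤ remainder α k u := by
  induction k generalizing u with
  | zero => simp [remainder]
  | succ k ih => exact mul_nonneg (by positivity) (ih (by linarith))

theorem remainder_le_exp {α : ℝ} (hα0 : 0 < α) (hα1 : α < 1) (k : ℕ) {u : ℝ} (hu : 0 < u) :
    remainder α k u ≤ Real.exp (-∑ j ∈ Finset.range k, (1 - α) / (u + 1 + j * α)) := by
  induction k generalizing u with
  | zero => simp [remainder]
  | succ k ih =>
    rw [Finset.sum_range_succ', neg_add_rev, Real.exp_add, remainder]
    have h := ih (u := u + α) (by linarith)
    -- The left side is 1 - (1 - α)/(u + 1).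
    have h1 : (u + α) / (u + 1) ≤ Real.exp (-((1 - α) / (u + 1 + (0 : ℕ) * α))) := by
      refine le_trans (le_of_eq ?_) (Real.one_sub_le_exp_neg _)
      have : u + 1 ≠ 0 := by linarith
      rw [Nat.cast_zero, zero_mul, add_zero]
      field_simp
      ring
    have h2 : ∀ j ∈ Finset.range k, (1 - α) / (u + α + 1 + j * α) =
        (1 - α) / (u + 1 + (j + 1 : ℕ) * α) := fun j _ => by
      push_cast; congr 1; ring
    rw [Finset.sum_congr rfl h2] at h
    exact mul_le_mul h1 h (remainder_nonneg hα0 k (by linarith)) (Real.exp_pos _).le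

/-- The exponent is bounded by comparison with the harmonic series, using u + 1 + jα ≤ (u + 1)(j +
1). -/
theorem tendsto_remainder {α : ℝ} (hα0 : 0 < α) (hα1 : α < 1) {u : ℝ} (hu : 0 < u) :
    Filter.Tendsto (fun k => ENNReal.ofReal (remainder α k u)) Filter.atTop (nhds 0) := by
  have hc : 0 < (1 - α) / (u + 1) := div_pos (by linarith) (by linarith)
  have hlim : Filter.Tendsto (fun k : ℕ => ENNReal.ofReal (Real.exp
      (-((1 - α) / (u + 1) * ∑ j ∈ Finset.range k, 1 / ((j : ℝ) + 1))))) Filter.atTop (nhds 0) := by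
    rw [← ENNReal.ofReal_zero]
    refine ENNReal.tendsto_ofReal (Real.tendsto_exp_neg_atTop_nhds_zero.comp ?_)
    exact Filter.Tendsto.const_mul_atTop hc Real.tendsto_sum_range_one_div_nat_succ_atTop
  refine tendsto_of_tendsto_of_tendsto_of_le_of_le tendsto_const_nhds hlim
    (fun _ => zero_le) fun k => ENNReal.ofReal_le_ofReal ?_
  refine (remainder_le_exp hα0 hα1 k hu).trans (Real.exp_le_exp.2 (neg_le_neg ?_))
  rw [Finset.mul_sum]
  refine Finset.sum_le_sum fun j _ => ?_
  rw [div_mul_div_comm, mul_one]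
  have hj : (0 : ℝ) ≤ j := j.cast_nonneg
  refine div_le_div_of_nonneg_left (by linarith) (by positivity) ?_
  nlinarith [mul_nonneg hu.le hj, mul_le_mul_of_nonneg_left hα1.le hj]

/-- Induction on the number of sticks broken off; the parameters, the functional and its constant
all change at each step. Two inequalities stand in for an absolute difference in `ℝ≥0∞`. -/
theorem lintegral_mixLaw_le_and_ge {α : ℝ} (hα0 : 0 < α) (hα1 : α < 1) (H : Measure I)
    [IsProbabilityMeasure H] (k : ℕ) {t s : ℝ} (ht : 0 < t) (hs : 0 < s) {c : ℝ≥0∞}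
    {F : Measure I → ℝ≥0∞} (hF : IsSubprobLipschitz c F) :
    ∫⁻ ν, F ν ∂mixLaw α t s H ≤
        ∫⁻ ν, F ν ∂law α (t + s) H + c * ENNReal.ofReal (remainder α k (t + s)) ∧
      ∫⁻ ν, F ν ∂law α (t + s) H ≤
        ∫⁻ ν, F ν ∂mixLaw α t s H + c * ENNReal.ofReal (remainder α k (t + s)) := by
  induction k generalizing t s c F with
  | zero =>
    have := isProbabilityMeasure_law_of_pos hα0 hα1 (add_pos ht hs) H
    have := isProbabilityMeasure_mixLaw hα0 hα1 ht hs H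
    have h1 := ae_law_univ_le_one hα0 hα1 (add_pos ht hs) H
    have h2 := ae_mixLaw_univ_le_one hα0 hα1 ht hs H
    simp only [remainder, ENNReal.ofReal_one, mul_one]
    exact ⟨hF.lintegral_le h2 h1, hF.lintegral_le h1 h2⟩
  | succ k ih =>
    have hu : 0 < t + s := add_pos ht hs
    have hG := hF.stick hα1 (by linarith : 0 < t + s + α) H
    have h1 := ih (t := t + α) (by linarith) hs hG
    have h2 := ih (t := s + α) (by linarith) ht hG
    rw [show t + α + s = t + s + α by ring] at h1
    rw [show s + α + t = t + s + α by ring] at h2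
    have hw : ENNReal.ofReal (t / (t + s)) + ENNReal.ofReal (s / (t + s)) = 1 := by
      rw [← ENNReal.ofReal_add (by positivity) (by positivity), ← add_div, div_self hu.ne',
        ENNReal.ofReal_one]
    have hc : c * ENNReal.ofReal (remainder α (k + 1) (t + s)) =
        c * ENNReal.ofReal ((t + s + α) / (t + s + 1)) *
          ENNReal.ofReal (remainder α k (t + s + α)) := by
      rw [remainder, ENNReal.ofReal_mul (by positivity), mul_assoc]
    rw [lintegral_mixLaw_eq_add hα0 hα1 ht hs H hF.measurable,
      lintegral_law_eq_lintegral_stick hα0 hα1 H hu hF.measurable, hc]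
    -- What remains is arithmetic: both mixture integrals are within `d` of `x`, hence so is their
    -- convex combination.
    generalize c * ENNReal.ofReal ((t + s + α) / (t + s + 1)) *
          ENNReal.ofReal (remainder α k (t + s + α)) = d at h1 h2 ⊢
    generalize ∫⁻ ν, stick α (t + s) H F ν ∂law α (t + s + α) H = x at h1 h2 ⊢
    generalize ∫⁻ ν, stick α (t + s) H F ν ∂mixLaw α (t + α) s H = y at h1 h2 ⊢
    generalize ∫⁻ ν, stick α (t + s) H F ν ∂mixLaw α (s + α) t H = y' at h1 h2 ⊢
    generalize ENNReal.ofReal (t / (t + s)) = w at hw ⊢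
    generalize ENNReal.ofReal (s / (t + s)) = w' at hw ⊢
    constructor
    · calc w * y + w' * y' ≤ w * (x + d) + w' * (x + d) := by gcongr <;> [exact h1.1; exact h2.1]
        _ = (w + w') * (x + d) := by ring
        _ = x + d := by rw [hw, one_mul]
    · calc x = (w + w') * x := by rw [hw, one_mul]
        _ = w * x + w' * x := by ring
        _ ≤ w * (y + d) + w' * (y' + d) := by gcongr <;> [exact h1.2; exact h2.2]
        _ = w * y + w' * y' + (w + w') * d := by ring
        _ = _ := by rw [hw, one_mul]

theorem lintegral_mixLaw_eq_lintegral_law {α : ℝ} (hα0 : 0 < α) (hα1 : α < 1) (H : Measure I)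
    [IsProbabilityMeasure H] {t s : ℝ} (ht : 0 < t) (hs : 0 < s) {c : ℝ≥0∞} (hc : c ≠ ∞)
    {F : Measure I → ℝ≥0∞} (hF : IsSubprobLipschitz c F) :
    ∫⁻ ν, F ν ∂mixLaw α t s H = ∫⁻ ν, F ν ∂law α (t + s) H := by
  have hlim : ∀ x : ℝ≥0∞, Filter.Tendsto
      (fun k => x + c * ENNReal.ofReal (remainder α k (t + s))) Filter.atTop (nhds x) := fun x => by
    have h := ENNReal.Tendsto.const_mul (tendsto_remainder hα0 hα1 (add_pos ht hs)) (.inr hc)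
    simpa using h.const_add x
  exact le_antisymm
    (ge_of_tendsto' (hlim _) fun k => (lintegral_mixLaw_le_and_ge hα0 hα1 H k ht hs hF).1)
    (ge_of_tendsto' (hlim _) fun k => (lintegral_mixLaw_le_and_ge hα0 hα1 H k ht hs hF).2)

/-! ### Lipschitz functionals determine the law -/

/-- Evaluation of a measure at finitely many sets, as a real vector. -/
noncomputable def evalReal {ι : Type*} (A : ι → Set I) (ν : Measure I) : ι → ℝ :=
  fun i => (ν (A i)).toReal

theorem measurable_evalReal {ι : Type*} {A : ι → Set I} (hA : ∀ i, MeasurableSet (A i)) :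
    Measurable (evalReal A) :=
  measurable_pi_iff.2 fun i => (Measure.measurable_coe (hA i)).ennreal_toReal

/-- Replacing ν by ν' inside a part of mass r moves each evaluation by at most r, hence the vector
by at most r in the sup metric. -/
theorem isSubprobLipschitz_comp_evalReal {ι : Type*} [Fintype ι] {A : ι → Set I}
    (hA : ∀ i, MeasurableSet (A i)) {K : NNReal} {f : (ι → ℝ) → NNReal} (hf : LipschitzWith K f) :
    IsSubprobLipschitz (K : ℝ≥0∞) fun ν : Measure I => (f (evalReal A ν) : ℝ≥0∞) where
  measurable := (hf.continuous.measurable.comp (measurable_evalReal hA)).coe_nnreal_ennreal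
  le_add r ξ ν ν' hr hν hν' := by
    have hr1 : r ≤ 1 := le_add_self.trans hr
    have hrt : r ≠ ∞ := ne_top_of_le_ne_top ENNReal.one_ne_top hr1
    have hξt : ∀ s, ξ s ≠ ∞ := fun s => ne_top_of_le_ne_top ENNReal.one_ne_top
      ((measure_mono (Set.subset_univ s)).trans (le_self_add.trans hr))
    have hb : ∀ {η : Measure I}, η Set.univ ≤ 1 → ∀ s, η s ≤ 1 := fun h s =>
      (measure_mono (Set.subset_univ s)).trans h
    have htop : ∀ {η : Measure I}, η Set.univ ≤ 1 → ∀ s, η s ≠ ∞ := fun h s =>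
      ne_top_of_le_ne_top ENNReal.one_ne_top (hb h s)
    have hval : ∀ {η : Measure I}, η Set.univ ≤ 1 → ∀ i,
        evalReal A (ξ + r • η) i = (ξ (A i)).toReal + r.toReal * (η (A i)).toReal := by
      intro η hη i
      simp only [evalReal, Measure.add_apply, Measure.smul_apply, smul_eq_mul]
      rw [ENNReal.toReal_add (hξt _) (ENNReal.mul_ne_top hrt (htop hη _)), ENNReal.toReal_mul]
    have hd : dist (evalReal A (ξ + r • ν)) (evalReal A (ξ + r • ν')) ≤ r.toReal := by
      refine (dist_pi_le_iff ENNReal.toReal_nonneg).2 fun i => ?_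
      have hu : ∀ {η : Measure I}, η Set.univ ≤ 1 → (η (A i)).toReal ≤ 1 := fun h =>
        ENNReal.toReal_le_of_le_ofReal zero_le_one (by simpa using hb h (A i))
      rw [hval hν, hval hν', Real.dist_eq, add_sub_add_left_eq_sub, ← mul_sub, abs_mul,
        abs_of_nonneg ENNReal.toReal_nonneg]
      refine mul_le_of_le_one_right ENNReal.toReal_nonneg (abs_sub_le_iff.2 ⟨?_, ?_⟩)
      · linarith [hu hν, ENNReal.toReal_nonneg (a := ν' (A i))]
      · linarith [hu hν', ENNReal.toReal_nonneg (a := ν (A i))]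
    have hF := (hf.dist_le_mul _ _).trans (mul_le_mul_of_nonneg_left hd K.coe_nonneg)
    rw [NNReal.dist_eq] at hF
    have hF' := (abs_sub_le_iff.1 hF).1
    rw [← ENNReal.coe_toNNReal hrt, ← ENNReal.coe_mul, ← ENNReal.coe_add, ENNReal.coe_le_coe,
      ← NNReal.coe_le_coe]
    push_cast
    rw [ENNReal.coe_toNNReal hrt]
    simpa using (by linarith : ((f (evalReal A (ξ + r • ν)) : NNReal) : ℝ) ≤
      f (evalReal A (ξ + r • ν')) + K * r.toReal)

/-- The `σ`-algebra on measures is generated by the evaluation map into a product space. -/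
theorem instMeasurableSpace_le_comap_eval :
    (Measure.instMeasurableSpace : MeasurableSpace (Measure I)) ≤
      MeasurableSpace.comap (fun ν (A : {A : Set I // MeasurableSet A}) => ν A.1)
        MeasurableSpace.pi := by
  refine iSup₂_le fun s hs => ?_
  rw [show (fun ν : Measure I => ν s) = (fun f : {A : Set I // MeasurableSet A} → ℝ≥0∞ =>
    f ⟨s, hs⟩) ∘ fun ν A => ν A.1 from rfl, ← MeasurableSpace.comap_comp]
  exact MeasurableSpace.comap_mono (measurable_pi_apply _).comap_le

/-- Laws of random sub-probability measures are determined by Lipschitz functionals. -/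
theorem ext_of_forall_isSubprobLipschitz {ρ ρ' : Measure (Measure I)} [IsFiniteMeasure ρ]
    [IsFiniteMeasure ρ'] (hρ : ∀ᵐ ν ∂ρ, ν Set.univ ≤ 1) (hρ' : ∀ᵐ ν ∂ρ', ν Set.univ ≤ 1)
    (h : ∀ (c : NNReal) (F : Measure I → ℝ≥0∞), IsSubprobLipschitz (c : ℝ≥0∞) F →
      ∫⁻ ν, F ν ∂ρ = ∫⁻ ν, F ν ∂ρ') : ρ = ρ' := by
  set Φ : Measure I → {A : Set I // MeasurableSet A} → ℝ≥0∞ := fun ν A => ν A.1 with hΦ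
  have mΦ : Measurable Φ := measurable_pi_iff.2 fun A => Measure.measurable_coe A.2
  have hfin : ∀ J : Finset {A : Set I // MeasurableSet A},
      ρ.map (evalReal fun A : J => A.1.1) = ρ'.map (evalReal fun A : J => A.1.1) := by
    intro J
    have mJ : Measurable (evalReal fun A : J => A.1.1) := measurable_evalReal fun A => A.1.2
    refine ext_of_generate_finite _ (BorelSpace.measurable_eq.trans borel_eq_generateFrom_isClosed)
      isPiSystem_isClosed ?_ ?_
    · intro E hE
      -- Indicators of closed sets are limits of thickened indicators, which are Lipschitz for each
      -- fixed positive thickness.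
      have hpos : ∀ n : ℕ, (0 : ℝ) < 1 / ((n : ℝ) + 1) := fun n => Nat.one_div_pos_of_nat
      have l1 := tendsto_lintegral_thickenedIndicator_of_isClosed
        (ρ.map (evalReal fun A : J => A.1.1)) hE hpos tendsto_one_div_add_atTop_nhds_zero_nat
      have l2 := tendsto_lintegral_thickenedIndicator_of_isClosed
        (ρ'.map (evalReal fun A : J => A.1.1)) hE hpos tendsto_one_div_add_atTop_nhds_zero_nat
      refine tendsto_nhds_unique l1 (l2.congr fun n => ?_)
      have hlip := lipschitzWith_thickenedIndicator (hpos n) E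
      rw [lintegral_map hlip.continuous.measurable.coe_nnreal_ennreal mJ,
        lintegral_map hlip.continuous.measurable.coe_nnreal_ennreal mJ]
      exact (h _ _ (isSubprobLipschitz_comp_evalReal (fun A : J => A.1.2) hlip)).symm
    · rw [Measure.map_apply mJ MeasurableSet.univ, Measure.map_apply mJ MeasurableSet.univ]
      -- The constant functional gives equality of total masses.
      have h1 := h 0 (fun _ => 1) ⟨measurable_const, fun _ _ _ _ _ _ _ => by simp⟩
      simpa using h1
  have hproj : ∀ (η : Measure (Measure I)), (∀ᵐ ν ∂η, ν Set.univ ≤ 1) →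
      ∀ J : Finset {A : Set I // MeasurableSet A}, (η.map Φ).map J.restrict =
        (η.map (evalReal fun A : J => A.1.1)).map fun x A => ENNReal.ofReal (x A) := by
    intro η hη J
    -- The mass bound makes all evaluations finite, so the real vector loses no information.
    rw [Measure.map_map (by fun_prop) mΦ,
      Measure.map_map (by fun_prop) (measurable_evalReal fun A : J => A.1.2)]
    refine Measure.map_congr (hη.mono fun ν hν => ?_)
    ext A
    exact (ENNReal.ofReal_toReal (ne_top_of_le_ne_top ENNReal.one_ne_top
      ((measure_mono (Set.subset_univ _)).trans hν))).symm
  have hmap : ρ.map Φ = ρ'.map Φ :=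
    IsProjectiveLimit.unique (P := fun J : Finset {A : Set I // MeasurableSet A} =>
      (ρ'.map Φ).map J.restrict)
      (fun J => by rw [hproj ρ hρ, hfin]; exact (hproj ρ' hρ' J).symm) fun J => rfl
  ext s hs
  obtain ⟨B, hB, rfl⟩ := instMeasurableSpace_le_comap_eval s hs
  rw [← Measure.map_apply mΦ hB, ← Measure.map_apply mΦ hB, hmap]

/-- Additivity of the Poisson–Dirichlet laws in the parameter `t`, under beta mixing. -/
theorem mixLaw_eq_law {α : ℝ} (hα0 : 0 < α) (hα1 : α < 1) (H : Measure I)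
    [IsProbabilityMeasure H] {t s : ℝ} (ht : 0 < t) (hs : 0 < s) :
    mixLaw α t s H = law α (t + s) H := by
  have := isProbabilityMeasure_law_of_pos hα0 hα1 (add_pos ht hs) H
  have := isProbabilityMeasure_mixLaw hα0 hα1 ht hs H
  exact ext_of_forall_isSubprobLipschitz (ae_mixLaw_univ_le_one hα0 hα1 ht hs H)
    (ae_law_univ_le_one hα0 hα1 (add_pos ht hs) H) fun c F hF =>
    lintegral_mixLaw_eq_lintegral_law hα0 hα1 H ht hs ENNReal.coe_ne_top hF

/-! ### Joint independence from product laws -/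

section Independence

variable {Ω E E' : Type*} [MeasurableSpace Ω] [MeasurableSpace E] [MeasurableSpace E']
  {μ : Measure Ω} [IsProbabilityMeasure μ]

theorem iIndepFun_finCons {n : ℕ} {X₀ : Ω → E} {X : Fin n → Ω → E} (h₀ : AEMeasurable X₀ μ)
    (h : ∀ i, AEMeasurable (X i) μ) (hX : iIndepFun X μ) (hX₀ : IndepFun X₀ (fun ω i => X i ω) μ) :
    iIndepFun (Fin.cons X₀ X : Fin (n + 1) → Ω → E) μ := by
  set Y : Fin (n + 1) → Ω → E := Fin.cons X₀ X with hY
  have hYm : ∀ i, AEMeasurable (Y i) μ := Fin.cases h₀ h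
  have hp : ∀ i, IsProbabilityMeasure (μ.map (Y i)) := fun i =>
    Measure.isProbabilityMeasure_map (hYm i)
  have hp' : ∀ i, IsProbabilityMeasure (μ.map (X i)) := fun i =>
    Measure.isProbabilityMeasure_map (h i)
  have hlaw : HasLaw (fun ω => (X₀ ω, fun i => X i ω))
      ((μ.map X₀).prod (Measure.pi fun i => μ.map (X i))) μ :=
    (indepFun_iff_hasLaw_prodMk_prod ⟨h₀, rfl⟩ (iIndepFun.hasLaw_pi (fun i => ⟨h i, rfl⟩) hX)).1 hX₀
  rw [iIndepFun_iff_hasLaw_pi_pi (μ := fun i => μ.map (Y i)) fun i => ⟨hYm i, rfl⟩]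
  convert (measurePreserving_piFinSuccAbove (fun i => μ.map (Y i)) 0).symm.fun_comp_hasLaw hlaw
    using 1
  ext ω i
  refine Fin.cases ?_ (fun j => ?_) i <;>
    simp [hY, MeasurableEquiv.piFinSuccAbove_symm_apply, Fin.insertNthEquiv]

/-- The two families together have a product of product laws; regrouping its coordinates in pairs
preserves the measure. -/
theorem iIndepFun_prodMk {ι : Type*} [Fintype ι] {X : ι → Ω → E} {Y : ι → Ω → E'}
    (hX : ∀ i, AEMeasurable (X i) μ) (hY : ∀ i, AEMeasurable (Y i) μ) (iX : iIndepFun X μ)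
    (iY : iIndepFun Y μ) (hXY : IndepFun (fun ω i => X i ω) (fun ω i => Y i ω) μ) :
    iIndepFun (fun i ω => (X i ω, Y i ω)) μ := by
  have hpX : ∀ i, IsProbabilityMeasure (μ.map (X i)) := fun i =>
    Measure.isProbabilityMeasure_map (hX i)
  have hpY : ∀ i, IsProbabilityMeasure (μ.map (Y i)) := fun i =>
    Measure.isProbabilityMeasure_map (hY i)
  have hlaw := (indepFun_iff_hasLaw_prodMk_prod
    (iIndepFun.hasLaw_pi (fun i => ⟨hX i, rfl⟩) iX)
    (iIndepFun.hasLaw_pi (fun i => ⟨hY i, rfl⟩) iY)).1 hXY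
  have hpair : ∀ i, HasLaw (fun ω => (X i ω, Y i ω)) ((μ.map (X i)).prod (μ.map (Y i))) μ :=
    fun i => (indepFun_iff_hasLaw_prodMk_prod ⟨hX i, rfl⟩ ⟨hY i, rfl⟩).1
      (hXY.comp (measurable_pi_apply i) (measurable_pi_apply i))
  rw [iIndepFun_iff_hasLaw_pi_pi hpair]
  exact (measurePreserving_arrowProdEquivProdArrow E E' ι (fun i => μ.map (X i))
    fun i => μ.map (Y i)).symm.fun_comp_hasLaw hlaw

end Independence

/-! ### Gamma-scaled processes and normalization -/

/-- The law of `G P` for independent `G ~ gamma(t, 1)` and `P ~ Π_{α,t}`. -/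
noncomputable def scaledLaw (α t : ℝ) (H : Measure I) : Measure (Measure I) :=
  ((gammaMeasure t 1).prod (law α t H)).map fun p => ENNReal.ofReal p.1 • p.2

/-- Division of a measure by its total mass. -/
noncomputable def normalize (ν : Measure I) : Measure I := (ν Set.univ)⁻¹ • ν

theorem measurable_normalize : Measurable (normalize : Measure I → Measure I) :=
  measurable_smul_measure (Measure.measurable_coe MeasurableSet.univ).inv measurable_id

theorem isProbabilityMeasure_scaledLaw {α : ℝ} (hα0 : 0 < α) (hα1 : α < 1) {t : ℝ} (ht : 0 < t)
    (H : Measure I) [IsProbabilityMeasure H] :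
    IsProbabilityMeasure (scaledLaw α t H) := by
  have := isProbabilityMeasure_gammaMeasure ht one_pos
  have := isProbabilityMeasure_law_of_pos hα0 hα1 ht H
  exact Measure.isProbabilityMeasure_map (Measurable.aemeasurable (by fun_prop))

theorem lintegral_scaledLaw {α : ℝ} (hα0 : 0 < α) (hα1 : α < 1) {t : ℝ} (ht : 0 < t)
    (H : Measure I) [IsProbabilityMeasure H]
    {F : Measure I → ℝ≥0∞} (hF : Measurable F) :
    ∫⁻ ν, F ν ∂scaledLaw α t H =
      ∫⁻ g, ∫⁻ ν, F (ENNReal.ofReal g • ν) ∂law α t H ∂gammaMeasure t 1 := by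
  have := isProbabilityMeasure_law_of_pos hα0 hα1 ht H
  rw [scaledLaw, lintegral_map hF (by fun_prop),
    lintegral_prod _ (Measurable.aemeasurable (by fun_prop))]

/-- When the process has mass one, the gamma factor is exactly the total mass of the product. -/
theorem map_normalize_scaledLaw {α : ℝ} (hα0 : 0 < α) (hα1 : α < 1) {t : ℝ} (ht : 0 < t)
    (H : Measure I) [IsProbabilityMeasure H]
    (h : ∀ᵐ ν ∂law α t H, ν Set.univ = 1) :
    (scaledLaw α t H).map normalize = law α t H := by
  have := isProbabilityMeasure_gammaMeasure ht one_pos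
  have := isProbabilityMeasure_law_of_pos hα0 hα1 ht H
  rw [scaledLaw, Measure.map_map measurable_normalize (by fun_prop)]
  have hae : normalize ∘ (fun p : ℝ × Measure I => ENNReal.ofReal p.1 • p.2)
      =ᵐ[(gammaMeasure t 1).prod (law α t H)] Prod.snd := by
    filter_upwards [Measure.quasiMeasurePreserving_fst.ae (ae_gammaMeasure_pos t 1),
      Measure.quasiMeasurePreserving_snd.ae h] with p hp1 hp2
    simp only [Function.comp_apply, normalize, Measure.smul_apply, smul_eq_mul, hp2, mul_one]
    rw [smul_smul, ENNReal.inv_mul_cancel (by simpa using hp1) ENNReal.ofReal_ne_top, one_smul]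
  rw [Measure.map_congr hae, Measure.map_snd_prod, measure_univ, one_smul]

/-- The laws of the gamma-scaled Poisson–Dirichlet processes form a convolution semigroup. -/
theorem scaledLaw_conv_scaledLaw {α : ℝ} (hα0 : 0 < α) (hα1 : α < 1) {t s : ℝ}
    (ht : 0 < t) (hs : 0 < s) (H : Measure I) [IsProbabilityMeasure H] :
    scaledLaw α t H ∗ scaledLaw α s H = scaledLaw α (t + s) H := by
  have hts : 0 < t + s := add_pos ht hs
  have := isProbabilityMeasureBeta ht hs
  have := isProbabilityMeasure_gammaMeasure ht one_pos
  have := isProbabilityMeasure_gammaMeasure hs one_pos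
  have := isProbabilityMeasure_gammaMeasure hts one_pos
  have := isProbabilityMeasure_law_of_pos hα0 hα1 ht H
  have := isProbabilityMeasure_law_of_pos hα0 hα1 hs H
  have := isProbabilityMeasure_scaledLaw hα0 hα1 hs H
  refine Measure.ext_of_lintegral _ fun F hF => ?_
  have m4 : Measurable fun q : ((ℝ × ℝ) × Measure I) × Measure I =>
      F (ENNReal.ofReal q.1.1.1 • q.1.2 + ENNReal.ofReal q.1.1.2 • q.2) := by fun_prop
  have m2 : Measurable fun q : ℝ × ℝ => ∫⁻ ν, ∫⁻ ν',
      F (ENNReal.ofReal q.1 • ν + ENNReal.ofReal q.2 • ν') ∂law α s H ∂law α t H :=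
    m4.lintegral_prod_right'.lintegral_prod_right'
  calc ∫⁻ ν, F ν ∂(scaledLaw α t H ∗ scaledLaw α s H)
      = ∫⁻ g, ∫⁻ ν, ∫⁻ g', ∫⁻ ν', F (ENNReal.ofReal g • ν + ENNReal.ofReal g' • ν')
          ∂law α s H ∂gammaMeasure s 1 ∂law α t H ∂gammaMeasure t 1 := by
        rw [Measure.lintegral_conv hF, lintegral_scaledLaw hα0 hα1 ht H
          (Measurable.lintegral_prod_right (by unfold Function.uncurry; fun_prop))]
        refine lintegral_congr fun g => lintegral_congr fun ν => ?_
        rw [lintegral_scaledLaw hα0 hα1 hs H (by fun_prop)]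
    _ = ∫⁻ g, ∫⁻ g', ∫⁻ ν, ∫⁻ ν', F (ENNReal.ofReal g • ν + ENNReal.ofReal g' • ν')
          ∂law α s H ∂law α t H ∂gammaMeasure s 1 ∂gammaMeasure t 1 := by
        refine lintegral_congr fun g => lintegral_lintegral_swap (Measurable.aemeasurable ?_)
        exact Measurable.lintegral_prod_right' (f := fun q : (Measure I × ℝ) × Measure I =>
          F (ENNReal.ofReal g • q.1.1 + ENNReal.ofReal q.1.2 • q.2)) (by fun_prop)
    -- Beta-gamma algebra turns the two scales into a gamma(t + s) total `w` and an independent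
    -- beta(t, s) fraction `b`.
    _ = ∫⁻ b, ∫⁻ w, ∫⁻ ν, ∫⁻ ν', F (ENNReal.ofReal (w * b) • ν + ENNReal.ofReal (w * (1 - b)) • ν')
          ∂law α s H ∂law α t H ∂gammaMeasure (t + s) 1 ∂betaMeasure t s :=
        lintegral_gammaMeasure_gammaMeasure ht hs (f := fun g g' => ∫⁻ ν, ∫⁻ ν',
          F (ENNReal.ofReal g • ν + ENNReal.ofReal g' • ν') ∂law α s H ∂law α t H) m2
    _ = ∫⁻ w, ∫⁻ b, ∫⁻ ν, ∫⁻ ν', F (ENNReal.ofReal (w * b) • ν + ENNReal.ofReal (w * (1 - b)) • ν')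
          ∂law α s H ∂law α t H ∂betaMeasure t s ∂gammaMeasure (t + s) 1 :=
        lintegral_lintegral_swap (Measurable.aemeasurable
          (m2.comp (g := fun q => _) (f := fun q : ℝ × ℝ => (q.2 * q.1, q.2 * (1 - q.1)))
            (by fun_prop)))
    _ = ∫⁻ w, ∫⁻ ν, F (ENNReal.ofReal w • ν) ∂mixLaw α t s H ∂gammaMeasure (t + s) 1 := by
        refine lintegral_congr_ae ((ae_gammaMeasure_pos _ _).mono fun w hw => ?_)
        beta_reduce
        rw [lintegral_mixLaw hα0 hα1 ht hs H (by fun_prop)]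
        simp only [mix, smul_add, smul_smul, ENNReal.ofReal_mul hw.le]
    _ = _ := by rw [mixLaw_eq_law hα0 hα1 H ht hs, lintegral_scaledLaw hα0 hα1 hts H hF]

/-- The semigroup is indexed by positive parameters only, hence the induction over nonempty index
sets. -/
theorem hasLaw_sum_scaledLaw {Ω ι : Type*} [MeasurableSpace Ω] {μ : Measure Ω} {α : ℝ}
    (hα0 : 0 < α) (hα1 : α < 1) (H : Measure I) [IsProbabilityMeasure H] {p : ι → ℝ}
    (hp : ∀ i, 0 < p i) {Y : ι → Ω → Measure I} (hY : ∀ i, HasLaw (Y i) (scaledLaw α (p i) H) μ)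
    (hi : iIndepFun Y μ) {S : Finset ι} (hS : S.Nonempty) :
    HasLaw (∑ i ∈ S, Y i) (scaledLaw α (∑ i ∈ S, p i) H) μ := by
  induction hS using Finset.Nonempty.cons_induction with
  | singleton a => simpa using hY a
  | cons a S ha hS ih =>
    have hpS : 0 < ∑ i ∈ S, p i := Finset.sum_pos (fun i _ => hp i) hS
    have := isProbabilityMeasure_scaledLaw hα0 hα1 (hp a) H
    have := isProbabilityMeasure_scaledLaw hα0 hα1 hpS H
    rw [Finset.sum_cons, Finset.sum_cons, ← scaledLaw_conv_scaledLaw hα0 hα1 (hp a) hpS H]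
    exact IndepFun.hasLaw_add (hY a) ih
      (hi.indepFun_finsetSum_of_notMem₀ (fun i => (hY i).aemeasurable) ha).symm

end PoissonDirichlet

/-! ### Normalizing the sum of n + 1 scaled processes -/

theorem proposition4p1 {I : Type*} [TopologicalSpace I] [PolishSpace I] [MeasurableSpace I]
    [BorelSpace I] (H : Measure I) [IsProbabilityMeasure H] [NullSingletonClass H]
    (α θ : ℝ) (hα0 : 0 < α) (hα1 : α < 1) (hθ : 0 < θ) (n : ℕ)
    -- the probability space of the left-hand side
    {Ω' : Type*} [MeasurableSpace Ω'] (μ' : Measure Ω') [IsProbabilityMeasure μ']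
    (Q : Ω' → ProbabilityMeasure I)
    (hQ : PoissonDirichlet.IsProcess α (θ + n * α) H Q μ')
    -- the probability space of the right-hand side
    {Ω : Type*} [MeasurableSpace Ω] (μ : Measure Ω) [IsProbabilityMeasure μ]
    (P₀ : Ω → ProbabilityMeasure I) (P : Fin n → Ω → ProbabilityMeasure I)
    (G₀ : Ω → ℝ) (G : Fin n → Ω → ℝ)
    (hP₀ : PoissonDirichlet.IsProcess α θ H P₀ μ)
    (hP : ∀ i, PoissonDirichlet.IsProcess α α H (P i) μ)
    (hG₀ : HasLaw G₀ (gammaMeasure θ 1) μ)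
    (hG : ∀ i, HasLaw (G i) (gammaMeasure α 1) μ)
    -- the random elements `P₀, (P i), G₀, (G i)` are mutually independent
    (hPindep : iIndepFun P μ)
    (hP₀P : IndepFun P₀ (fun ω i => P i ω) μ)
    (hGindep : iIndepFun G μ)
    (hG₀G : IndepFun G₀ (fun ω i => G i ω) μ)
    (hPG : IndepFun (fun ω => (P₀ ω, fun i => P i ω)) (fun ω => (G₀ ω, fun i => G i ω)) μ) :
    IdentDistrib (fun ω => (Q ω : Measure I))
      (fun ω =>
        ENNReal.ofReal (G₀ ω / (G₀ ω + ∑ j, G j ω)) • (P₀ ω : Measure I) +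
          ∑ i, ENNReal.ofReal (G i ω / (G₀ ω + ∑ j, G j ω)) • (P i ω : Measure I))
      μ' μ := by
  have hu : 0 < θ + n * α := by positivity
  set p : Fin (n + 1) → ℝ := Fin.cons θ fun _ => α with hp
  have hppos : ∀ i, 0 < p i := Fin.cases hθ fun _ => hα0
  have hpsum : ∑ i, p i = θ + n * α := by simp [hp, Fin.sum_univ_succ]
  set X : Fin (n + 1) → Ω → ProbabilityMeasure I := Fin.cons P₀ P with hX
  set g : Fin (n + 1) → Ω → ℝ := Fin.cons G₀ G with hg
  have hcoe : Measurable fun ν : ProbabilityMeasure I => (ν : Measure I) := measurable_subtype_coe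
  -- the laws and the joint independence of the random measures and of the gamma variables
  have hXlaw : ∀ i, HasLaw (fun ω => (X i ω : Measure I)) (PoissonDirichlet.law α (p i) H) μ :=
    Fin.cases hP₀ hP
  have hglaw : ∀ i, HasLaw (g i) (gammaMeasure (p i) 1) μ := Fin.cases hG₀ hG
  have hXm : ∀ i, AEMeasurable (fun ω => (X i ω : Measure I)) μ := fun i => (hXlaw i).aemeasurable
  have hPc : Measurable fun (x : Fin n → ProbabilityMeasure I) i => (x i : Measure I) :=
    measurable_pi_iff.2 fun i => hcoe.comp (measurable_pi_apply i)
  have iX : iIndepFun (fun i ω => (X i ω : Measure I)) μ := by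
    have h := PoissonDirichlet.iIndepFun_finCons (X₀ := fun ω => (P₀ ω : Measure I))
      (X := fun i ω => (P i ω : Measure I)) hP₀.aemeasurable (fun i => (hP i).aemeasurable)
      (hPindep.comp (fun _ ν => (ν : Measure I)) fun _ => hcoe)
      (hP₀P.comp hcoe hPc)
    convert h using 1
    ext i : 1
    refine Fin.cases ?_ (fun j => ?_) i <;> rfl
  have ig : iIndepFun g μ := PoissonDirichlet.iIndepFun_finCons hG₀.aemeasurable
    (fun i => (hG i).aemeasurable) hGindep hG₀G
  have iXg : IndepFun (fun ω i => (X i ω : Measure I)) (fun ω i => g i ω) μ := by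
    have h := hPG.comp
      (φ := fun q => (Fin.cons (q.1 : Measure I) fun i => (q.2 i : Measure I) :
        Fin (n + 1) → Measure I))
      (ψ := fun q => (Fin.cons q.1 q.2 : Fin (n + 1) → ℝ))
      (measurable_pi_iff.2 (Fin.cases (hcoe.comp measurable_fst) fun j =>
        hcoe.comp ((measurable_pi_apply j).comp measurable_snd)))
      (measurable_pi_iff.2 (Fin.cases measurable_fst fun j =>
        (measurable_pi_apply j).comp measurable_snd))
    convert h using 1 <;> (ext ω i : 2; refine Fin.cases ?_ (fun j => ?_) i <;> rfl)
  -- the scaled random measures and their sum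
  set Y : Fin (n + 1) → Ω → Measure I := fun i ω => ENNReal.ofReal (g i ω) • (X i ω : Measure I)
    with hY
  have hm : Measurable fun q : Measure I × ℝ => ENNReal.ofReal q.2 • q.1 := by fun_prop
  have hYlaw : ∀ i, HasLaw (Y i) (PoissonDirichlet.scaledLaw α (p i) H) μ := fun i => by
    have := isProbabilityMeasure_gammaMeasure (hppos i) one_pos
    have := PoissonDirichlet.isProbabilityMeasure_law_of_pos hα0 hα1 (hppos i) H
    have hpair := (indepFun_iff_hasLaw_prodMk_prod (hglaw i) (hXlaw i)).1
      (iXg.comp (measurable_pi_apply i) (measurable_pi_apply i)).symm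
    exact (MeasurePreserving.mk (f := fun q : ℝ × Measure I => ENNReal.ofReal q.1 • q.2)
      (by fun_prop) rfl).fun_comp_hasLaw hpair
  have iY : iIndepFun Y μ :=
    (PoissonDirichlet.iIndepFun_prodMk hXm (fun i => (hglaw i).aemeasurable) iX ig iXg).comp
      (fun _ q => ENNReal.ofReal q.2 • q.1) fun _ => hm
  have hsum := PoissonDirichlet.hasLaw_sum_scaledLaw hα0 hα1 H hppos hYlaw iY
    (S := Finset.univ) Finset.univ_nonempty
  rw [hpsum] at hsum
  -- Total mass one is read off from `Q`, which takes values in probability measures, instead of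
  -- being computed from the weights.
  have hone : ∀ᵐ ν ∂PoissonDirichlet.law α (θ + n * α) H, ν Set.univ = 1 :=
    (hQ.ae_iff (measurableSet_setOfPred.1 (measurableSet_eq_fun
      (Measure.measurable_coe MeasurableSet.univ) measurable_const))).1
      (Filter.Eventually.of_forall fun ω => measure_univ)
  have hnorm : HasLaw (fun ω => PoissonDirichlet.normalize ((∑ i, Y i) ω))
      (PoissonDirichlet.law α (θ + n * α) H) μ :=
    (MeasurePreserving.mk PoissonDirichlet.measurable_normalize
      (PoissonDirichlet.map_normalize_scaledLaw hα0 hα1 hu H hone)).fun_comp_hasLaw hsum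
  have hpos : ∀ᵐ ω ∂μ, ∀ i, 0 < g i ω := ae_all_iff.2 fun i =>
    ((hglaw i).ae_iff (measurableSet_setOfPred.1 measurableSet_Ioi)).2
      (PoissonDirichlet.ae_gammaMeasure_pos _ _)
  have hR : HasLaw (fun ω =>
        ENNReal.ofReal (G₀ ω / (G₀ ω + ∑ j, G j ω)) • (P₀ ω : Measure I) +
          ∑ i, ENNReal.ofReal (G i ω / (G₀ ω + ∑ j, G j ω)) • (P i ω : Measure I))
      (PoissonDirichlet.law α (θ + n * α) H) μ := by
    refine hnorm.congr (hpos.mono fun ω hω => ?_)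
    have hS : ∑ i, g i ω = G₀ ω + ∑ j, G j ω := by simp [hg, Fin.sum_univ_succ]
    have hSpos : 0 < ∑ i, g i ω := Finset.sum_pos (fun i _ => hω i) Finset.univ_nonempty
    -- Each `X i ω` has mass one, so the sum has mass equal to the total of the gamma variables:
    -- normalizing yields the stated coefficients.
    have hmass : (∑ i, Y i) ω Set.univ = ENNReal.ofReal (∑ i, g i ω) := by
      rw [ENNReal.ofReal_sum_of_nonneg fun i _ => (hω i).le]
      simp [hY, Finset.sum_apply]
    have hdiv : ∀ i, ENNReal.ofReal (g i ω / ∑ i, g i ω) =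
        (ENNReal.ofReal (∑ i, g i ω))⁻¹ * ENNReal.ofReal (g i ω) := fun i => by
      rw [ENNReal.ofReal_div_of_pos hSpos, div_eq_mul_inv, mul_comm]
    calc _ = ∑ i, ENNReal.ofReal (g i ω / ∑ i, g i ω) • (X i ω : Measure I) := by
          rw [Fin.sum_univ_succ, hS]
          rfl
      _ = PoissonDirichlet.normalize ((∑ i, Y i) ω) := by
          rw [PoissonDirichlet.normalize, hmass, Finset.sum_apply, Finset.smul_sum]
          simp only [hdiv, hY, smul_smul]
  exact ⟨hQ.aemeasurable, hR.aemeasurable, hQ.map_eq.trans hR.map_eq.symm⟩
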